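/- Let $R$ be a reduced irreducible (crystallographic) root system of type $B_n$ or $D_{n+1}$ with $n\ge 3$, with a chosen base $\Delta$, positive roots $R^+$, Weyl group $W$ and height function $\mathrm{ht}$. Realize $R$ in the standard way, with simple roots $\alpha_i=\varepsilon_i-\varepsilon_{i-1}$ $(2\le i\le n)$ and $\alpha_1=\varepsilon_1$ in type $B_n$, resp. $\alpha_i=\varepsilon_i-\varepsilon_{i-1}$ $(1\le i\le n)$ and $\alpha_0=\varepsilon_1+\varepsilon_0$ in type $D_{n+1}$. For an integer $1\le m\le n$ let $R(m)$ be the root subsystem of all roots whose height is a multiple of $m$, $R^+(m)=R(m)\cap R^+$, $\Gamma(m)$ the set of simple roots of $R(m)$ with respect to $R^+(m)$ (the elements of $R^+(m)$ that are not sums of two elements of $R^+(m)$), and $R_m$ the set of roots of height $m$. Let $$d_m=\prod_{\beta\in R^+(m)}\frac{\langle \rho/m,\beta\rangle}{\langle\rho_m,\beta\rangle},$$ where $\rho$ and $\rho_m$ are the half-sums of the coroots $\beta^\vee$ of the $\beta\in R^+$ and of the $\beta\in R^+(m)$, respectively. A root subsystem of $R$ is of Levi type if it is $W$-conjugate to the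 root subsystem generated by a subset of $\Delta$. Write $n=qm+t$ with $0\le t\le m-1$, and set $k=\lfloor m/2\rfloor$. Denote by $BD_q$ the diagram $B_q$ if $R=B_n$ and $D_{q+1}$ if $R=D_{n+1}$ (with $B_1=A_1$, $D_2=2A_1$, $D_3=A_3$, $A_0=\varnothing$). Then: (a) If $m=2k+1$, then $R(m)$ is of Levi type and has type $$BD_q+\begin{cases} iA_{2q+1}+(k-i)A_{2q} & \text{if } t=k+i \text{ with } i=1,\dots,k,\\ tA_{2q}+(k-t)A_{2q-1} & \text{if } t=0,\dots,k.\end{cases}$$ (b) If $m=2k$ and $n=m+t$ with $t=0,\dots,k-1$ (that is, $m\le n<3k$), then $R(m)$ is of Levi type and has type $BD_1+tA_2+(k-1-t)A_1$. (c) If $m=2k$ and $n\ge 3k$, then $R(m)$ is not of Levi type. In this case set $p=q$ if $t\ge k$, and $p=q-1$ if $t<k$ (then $q\ge 2$). Then $\Gamma(m)=R_m\cup\{\delta\}$, where $\delta=\varepsilon_k+\varepsilon_{3k}$ has height $2m$. Let $X^\dagger\subseteq\Gamma(m)$ consist of $\delta$ and the roots $\varepsilon_{k+cm}-\varepsilon_{k+(c-1)m}$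 for $c=1,\dots,p$. The roots of $X^\dagger$ are orthogonal to those of $\Gamma(m)\setminus X^\dagger$; for $p\ge 2$, $X^\dagger$ is the connected component of $\delta$ in the Dynkin diagram $\Gamma(m)$, and for $p=1$ it is the disconnected diagram $D_2=2A_1$. With $X^0=X^\dagger\setminus\{\delta\}$, and with the superscript $\dagger$ marking the part $X^\dagger$ of $\Gamma(m)$, one has $$\begin{array}{|c|c|c|c|}\hline & \Gamma(m) & X^0 & d_m\\ \hline t=k+i,\ i=0,\dots,k-1 & BD_q+(k-1-i)A_{2q}+iA_{2q+1}+D_{q+1}^\dagger & A_q & 2^q\\ \hline q\ge 2,\ t=0,\dots,k-1 & BD_q+tA_{2q}+(k-1-t)A_{2q-1}+D_q^\dagger & A_{q-1} & 2^{q-1}\\ \hline\end{array}$$ -/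

import Mathlib

namespace HeightSubsystem

open RootPairing

/-! ### Dynkin diagrams, encoded by Cartan matrices -/

/-- Disjoint union of two diagrams: the block diagonal Cartan matrix. -/
def diagramSum {κ κ' : Type} (A : Matrix κ κ ℤ) (B : Matrix κ' κ' ℤ) :
    Matrix (κ ⊕ κ') (κ ⊕ κ') ℤ :=
  Matrix.fromBlocks A 0 0 B

infixl:65 " ⊕ᴅ " => diagramSum

/-- Disjoint union of `c` copies of a diagram. -/
def copies {κ : Type} (c : ℕ) (A : Matrix κ κ ℤ) : Matrix (κ × Fin c) (κ × Fin c) ℤ :=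
  Matrix.blockDiagonal fun _ : Fin c => A

/-- The diagram of type `A_r` (with `A_0` empty); here `CartanMatrix.A r` has size `r`. -/
abbrev typeA (r : ℕ) : Matrix (Fin r) (Fin r) ℤ := CartanMatrix.A r

/-- The diagram of type `D_r`; in particular `D_2 = 2 A_1` and `D_3 = A_3`. -/
abbrev typeD (r : ℕ) : Matrix (Fin r) (Fin r) ℤ := CartanMatrix.D r

/-- The two families under consideration: `B_n` and `D_{n+1}`. -/
inductive Family : Type
  | B : Family
  | D : Family

/-- The rank of `B_n`, resp. `D_{n+1}`. -/
def Family.rank : Family → ℕ → ℕ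
  | .B, n => n
  | .D, n => n + 1

/-- The Cartan matrix `⟨α_i, α_j^∨⟩` of type `B_n`, resp. `D_{n+1}`: the diagram `BD_n`. -/
def Family.BD : (X : Family) → (n : ℕ) → Matrix (Fin (X.rank n)) (Fin (X.rank n)) ℤ
  | .B, n => CartanMatrix.B n
  | .D, n => CartanMatrix.D (n + 1)

/-! ### Sets of roots -/

section

variable {ι V N : Type*} [AddCommGroup V] [Module ℝ V] [AddCommGroup N] [Module ℝ N]
  (P : RootPairing ι ℝ V N)

/-- The set of roots `S` is a base of the set of roots `Q`. -/
def IsBaseOf (S Q : Set ι) : Prop :=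
  S ⊆ Q ∧ LinearIndepOn ℝ P.root S ∧
    ∀ i ∈ Q, P.root i ∈ AddSubmonoid.closure (P.root '' S) ∨
      -P.root i ∈ AddSubmonoid.closure (P.root '' S)

/-- The set of roots `S` has Dynkin diagram `A`. -/
def HasDiagram [P.IsCrystallographic] (S : Set ι) {κ : Type} (A : Matrix κ κ ℤ) : Prop :=
  ∃ f : κ ≃ S, ∀ x y : κ, P.pairingIn ℤ (f x) (f y) = A x y

/-- The root subsystem `Q` has type `A`: it has a base with Dynkin diagram `A`. -/
def HasType [P.IsCrystallographic] (Q : Set ι) {κ : Type} (A : Matrix κ κ ℤ) : Prop :=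
  ∃ S : Set ι, IsBaseOf P S Q ∧ HasDiagram P S A

/-- The root subsystem generated by a set `I` of roots: the smallest set of roots that
contains `I` and is stable under the reflections in its own elements. -/
def generatedSubsystem (I : Set ι) : Set ι :=
  ⋂₀ {S : Set ι | I ⊆ S ∧ ∀ i ∈ S, ∀ j ∈ S, P.reflectionPerm i j ∈ S}

/-- The connected component of `i` in the Dynkin diagram of `S` (for `i ∈ S`). -/
def component (S : Set ι) (i : ι) : Set ι :=
  {j | Relation.ReflTransGen (fun x y => y ∈ S ∧ P.pairing x y ≠ 0) i j}

variable {P}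
variable (b : P.Base)

/-- A set of roots is of Levi type if it is conjugate under the Weyl group to the root
subsystem generated by a set of simple roots. -/
def IsLeviType (Q : Set ι) : Prop :=
  ∃ w : P.weylGroup, ∃ I : Set ι, I ⊆ b.support ∧
    Q = P.weylGroupToPerm w '' generatedSubsystem P I

/-- `R(m)`: the roots whose height is a multiple of `m`. -/
def rootsMult (m : ℕ) : Set ι := {i | (m : ℤ) ∣ b.height i}

/-- `R⁺(m)`: the positive roots in `R(m)`. -/
def posRootsMult (m : ℕ) : Set ι := {i | i ∈ rootsMult b m ∧ b.IsPos i}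

/-- `R_m`: the roots of height `m`. -/
def rootsHeight (m : ℕ) : Set ι := {i | b.height i = m}

/-- `Γ(m)`: the simple roots of `R(m)` with respect to `R⁺(m)`, i.e. the elements of `R⁺(m)` that
are not the sum of two elements of `R⁺(m)`. -/
def simpleRootsMult (m : ℕ) : Set ι :=
  {i | i ∈ posRootsMult b m ∧
    ¬ ∃ j ∈ posRootsMult b m, ∃ l ∈ posRootsMult b m, P.root i = P.root j + P.root l}

open Classical in
/-- Half the sum of the coroots `β^∨` for `β` in a set `S` of roots. -/
noncomputable def halfSumCoroots [Fintype ι] (S : Set ι) : N :=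
  (1 / 2 : ℝ) • ∑ i with i ∈ S, P.coroot i

open Classical in
/-- The constant `d_m = ∏_{β ∈ R⁺(m)} ⟨ρ/m, β⟩ / ⟨ρ_m, β⟩`, where `ρ` and `ρ_m` are the half-sums of
the coroots of the elements of `R⁺` and of `R⁺(m)`. -/
noncomputable def dimConst [Fintype ι] (m : ℕ) : ℝ :=
  ∏ β with β ∈ posRootsMult b m,
    P.root' β ((1 / m : ℝ) • halfSumCoroots (P := P) {i | b.IsPos i}) /
      P.root' β (halfSumCoroots (P := P) (posRootsMult b m))

variable {b}

/-- The simple root `α_j` of `B_n` (`1 ≤ j ≤ n`), resp. `D_{n+1}` (`0 ≤ j ≤ n`), in the numbering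
`α_j = ε_j - ε_{j-1}` for `j ≥ 2` and
* `α_1 = ε_1` in type `B_n`;
* `α_1 = ε_1 - ε_0` and `α_0 = ε_1 + ε_0` in type `D_{n+1}`.

The order is the reverse of the one of the rows of the Cartan matrices in `Family.BD`, where `α_n`
comes first. The value outside the given range is `0`. -/
noncomputable def simpleRoot (X : Family) (n : ℕ) (e : Fin (X.rank n) ≃ b.support) (j : ℕ) : V :=
  if h : j ≤ n ∧ n - j < X.rank n then P.root (e ⟨n - j, h.2⟩) else 0

/-- The root `ε_k + ε_{3k}` of height `4k` in terms of the simple roots. -/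
noncomputable def deltaRoot (X : Family) (n : ℕ) (e : Fin (X.rank n) ≃ b.support) (k : ℕ) : V :=
  match X, e with
  | .B, e => 2 • ∑ j ∈ Finset.Icc 1 k, simpleRoot .B n e j +
      ∑ j ∈ Finset.Icc (k + 1) (3 * k), simpleRoot .B n e j
  | .D, e => simpleRoot .D n e 0 + simpleRoot .D n e 1 +
      2 • ∑ j ∈ Finset.Icc 2 k, simpleRoot .D n e j +
      ∑ j ∈ Finset.Icc (k + 1) (3 * k), simpleRoot .D n e j

/-- The roots `ε_{k+cm} - ε_{k+(c-1)m} = α_{k+(c-1)m+1} + ⋯ + α_{k+cm}`, for `c = 1, …, p`. -/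
def chainRoots (X : Family) (n : ℕ) (e : Fin (X.rank n) ≃ b.support) (m k p : ℕ) : Set ι :=
  {i | ∃ c : ℕ, 1 ≤ c ∧ c ≤ p ∧
    P.root i = ∑ j ∈ Finset.Icc (k + (c - 1) * m + 1) (k + c * m), simpleRoot X n e j}

/-- A row of the table for `m = 2k` and `n ≥ 3k`:
`Γ(m)` is the union of `R_m` and a root `δ = ε_k + ε_{3k}` of height `2m`, and has diagram
`rest + D_{p+1}^†`, where `X^† = D_{p+1}^†` consists of `δ` and of the roots
`ε_{k+cm} - ε_{k+(c-1)m}`, `c = 1, …, p`; moreover `X^0 = X^† - {δ}` has type `A_p` and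
`d_m = 2 ^ p`. If `p ≥ 2` then `X^†` is the connected component of `δ`; if `p = 1` it is the
disconnected diagram `D_2 = 2 A_1`. -/
def TableRow [Fintype ι] [P.IsCrystallographic] (X : Family) (n : ℕ)
    (e : Fin (X.rank n) ≃ b.support) (m k p : ℕ) {κ : Type} (rest : Matrix κ κ ℤ) : Prop :=
  ∃ δ : ι, P.root δ = deltaRoot X n e k ∧ b.height δ = 2 * m ∧
    simpleRootsMult b m = rootsHeight b m ∪ {δ} ∧
    IsBaseOf P (simpleRootsMult b m) (rootsMult b m) ∧
    HasDiagram P (simpleRootsMult b m) (rest ⊕ᴅ typeD (p + 1)) ∧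
    ∃ Xdag : Set ι, Xdag = chainRoots X n e m k p ∪ {δ} ∧
      Xdag ⊆ simpleRootsMult b m ∧
      (∀ i ∈ Xdag, ∀ j ∈ simpleRootsMult b m \ Xdag, P.IsOrthogonal i j) ∧
      (2 ≤ p → Xdag = component P (simpleRootsMult b m) δ) ∧
      HasDiagram P (simpleRootsMult b m \ Xdag) rest ∧
      HasDiagram P Xdag (typeD (p + 1)) ∧
      HasDiagram P (Xdag \ {δ}) (typeA p) ∧
      dimConst b m = 2 ^ p

end

end HeightSubsystem

open HeightSubsystem

/-!
Realise `R` in coordinates `ε 1, …, ε n` (and `ε 0` in type `D`), where `ε a` has height `a`. The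
roots `ε c - ε a` and `ε c + ε a` have heights `c - a` and `c + a`, so `R(m)` only links coordinates
whose indices agree modulo `m` up to sign, and the classes `{r, -r}` contribute orthogonal parts.
The class of `0` contributes `BD_q`. A class `{r, -r}` with `r ≠ -r` contributes a type `A`: after
changing the sign of the coordinates congruent to `-r`, its roots are the differences of
coordinates. The class of `m / 2` is its own opposite: it contributes a type `D` if it has at
least two elements and nothing otherwise.

If the class of `m / 2` has at most one element, then `R(m)` is the zero set of a linear functional,
so it is of Levi type. Otherwise the span of `R(m)` contains `ε (2k) + ε k`, whose height `3k` is
not a multiple of `m = 2k`, whereas a subsystem of Levi type contains all the roots in its span.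

For `d_m`, note that `⟨ρ/m, β⟩` and `⟨ρ_m, β⟩` agree unless `β = ε (k + cm) + ε (k + dm)`, where
they are `c + d + 1` and `c + d`; for each `c ≥ 1` the product over `d < c` telescopes to `2`.
-/

namespace HeightSubsystem

open RootPairing

section

variable {ι V N : Type*} [AddCommGroup V] [Module ℝ V] [AddCommGroup N] [Module ℝ N]
  {P : RootPairing ι ℝ V N}

lemma root_reflectionPerm_self (i : ι) : P.root (P.reflectionPerm i i) = -P.root i := by
  rw [root_reflectionPerm, reflection_apply_self]

lemma pairing_eq_cast_pairingIn [P.IsCrystallographic] (i j : ι) :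
    P.pairing i j = (P.pairingIn ℤ i j : ℝ) :=
  (P.algebraMap_pairingIn ℤ i j).symm

lemma not_isPos_reflectionPerm_self {b : P.Base} {i : ι} (hi : b.IsPos i) :
    ¬ b.IsPos (P.reflectionPerm i i) :=
  fun h => (Base.IsPos.neg_iff_not b i).1 h hi

lemma height_reflectionPerm [P.IsCrystallographic] (b : P.Base) (i j : ι) :
    b.height (P.reflectionPerm j i) = b.height i - P.pairingIn ℤ i j * b.height j := by
  have h : P.root (P.reflectionPerm j i) = P.root i + (-P.pairingIn ℤ i j) • P.root j := by
    rw [root_reflectionPerm, P.reflection_apply_root' ℤ, neg_smul, sub_eq_add_neg]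
  rw [b.height_add_zsmul h, smul_eq_mul, neg_mul, sub_eq_add_neg]

lemma posDef_rootForm [Fintype ι] [P.IsRootSystem] : P.RootForm.toQuadraticMap.PosDef := by
  intro x hx
  refine lt_of_le_of_ne (P.rootForm_self_sum_of_squares x).nonneg fun h => hx ?_
  exact P.eq_zero_of_mem_rootSpan_of_rootForm_self_eq_zero (by simp) h.symm

section HeightFunctional

variable [P.IsRootSystem] (b : P.Base)

/-- The height of a root, extended to a linear functional on the root space. -/
noncomputable def heightFun : V →ₗ[ℝ] ℝ := b.toWeightBasis.constr ℝ fun _ => (1 : ℝ)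

lemma heightFun_root_of_mem_support {i : ι} (hi : i ∈ b.support) :
    heightFun b (P.root i) = 1 := by
  rw [← b.toWeightBasis_apply ⟨i, hi⟩, heightFun, Module.Basis.constr_basis]

lemma heightFun_root (i : ι) : heightFun b (P.root i) = b.height i := by
  obtain ⟨f, -, -, hf⟩ := b.exists_root_eq_sum_int i
  rw [Base.height_eq_sum hf, hf, map_sum, Int.cast_sum]
  refine Finset.sum_congr rfl fun j hj => ?_
  rw [map_zsmul, heightFun_root_of_mem_support b hj, zsmul_one]

lemma coord_root_nonneg [Finite ι] [P.IsCrystallographic] {i : ι} (hi : b.IsPos i)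
    (j : b.support) : 0 ≤ b.toWeightBasis.coord j (P.root i) := by
  have hsimple : ∀ l ∈ b.support, 0 ≤ b.toWeightBasis.coord j (P.root l) := fun l hl => by
    rw [Module.Basis.coord_apply, b.toWeightBasis_repr_root ⟨l, hl⟩]
    exact Finsupp.single_nonneg.2 zero_le_one j
  refine hi.induction_on_add hsimple fun i l k hk hi hl => ?_
  rw [hk, map_add]
  exact add_nonneg hi (hsimple l hl)

lemma coord_eq_zero_of_mem_span {I : Set ι} (hI : I ⊆ b.support) {j : b.support}
    (hj : (j : ι) ∉ I) {v : V} (hv : v ∈ Submodule.span ℝ (P.root '' I)) :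
    b.toWeightBasis.coord j v = 0 := by
  suffices Submodule.span ℝ (P.root '' I) ≤ LinearMap.ker (b.toWeightBasis.coord j) from this hv
  rw [Submodule.span_le]
  rintro _ ⟨l, hl, rfl⟩
  have hlj : (⟨l, hI hl⟩ : b.support) ≠ j := fun h => hj (h ▸ hl)
  rw [SetLike.mem_coe, LinearMap.mem_ker, Module.Basis.coord_apply,
    b.toWeightBasis_repr_root ⟨l, hI hl⟩, Finsupp.single_eq_of_ne hlj.symm]

end HeightFunctional

section SimpleRootsMult

variable (b : P.Base) (m : ℕ)

lemma reflectionPerm_self_mem_rootsMult {i : ι} (hi : i ∈ rootsMult b m) :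
    P.reflectionPerm i i ∈ rootsMult b m := by
  change (m : ℤ) ∣ _
  exact b.height_reflectionPerm_self i ▸ (dvd_neg).2 hi

lemma mem_rootsMult_of_root_eq_sub {i j l : ι} (hi : i ∈ rootsMult b m) (hj : j ∈ rootsMult b m)
    (hl : P.root l = P.root i - P.root j) : l ∈ rootsMult b m := by
  change (m : ℤ) ∣ _
  rw [b.height_sub hl]
  exact dvd_sub hi hj

lemma reflectionPerm_mem_rootsMult [P.IsCrystallographic] {i j : ι} (hi : i ∈ rootsMult b m)
    (hj : j ∈ rootsMult b m) : P.reflectionPerm j i ∈ rootsMult b m := by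
  change (m : ℤ) ∣ _
  rw [height_reflectionPerm]
  exact dvd_sub hi (hj.mul_left _)

lemma mem_posRootsMult_or_reflectionPerm_self_mem {i : ι} (hi : i ∈ rootsMult b m) :
    i ∈ posRootsMult b m ∨ P.reflectionPerm i i ∈ posRootsMult b m :=
  (Base.IsPos.or_neg b i).imp (fun h => ⟨hi, h⟩)
    fun h => ⟨reflectionPerm_self_mem_rootsMult b m hi, h⟩

lemma root_mem_closure_simpleRootsMult {i : ι} (hi : i ∈ posRootsMult b m) :
    P.root i ∈ AddSubmonoid.closure (P.root '' simpleRootsMult b m) := by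
  induction hN : (b.height i).toNat using Nat.strong_induction_on generalizing i with
  | _ N ih =>
    by_cases hdec : ∃ j ∈ posRootsMult b m, ∃ l ∈ posRootsMult b m, P.root i = P.root j + P.root l
    · obtain ⟨j, hj, l, hl, h⟩ := hdec
      have hheight := b.height_add h
      have hjpos : 0 < b.height j := hj.2
      have hlpos : 0 < b.height l := hl.2
      rw [h]
      exact add_mem (ih _ (by omega) hj rfl) (ih _ (by omega) hl rfl)
    · exact AddSubmonoid.subset_closure ⟨i, ⟨hi, hdec⟩, rfl⟩

lemma sub_notMem_range_root_of_mem_simpleRootsMult {i j : ι} (hi : i ∈ simpleRootsMult b m)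
    (hj : j ∈ simpleRootsMult b m) : P.root i - P.root j ∉ Set.range P.root := by
  rintro ⟨l, hl⟩
  rcases mem_posRootsMult_or_reflectionPerm_self_mem b m
    (mem_rootsMult_of_root_eq_sub b m hi.1.1 hj.1.1 hl) with h | h
  · exact hi.2 ⟨l, h, j, hj.1, by rw [hl, sub_add_cancel]⟩
  · exact hj.2 ⟨_, h, i, hi.1, by rw [root_reflectionPerm_self, hl, neg_sub, sub_add_cancel]⟩

variable [Finite ι] [P.IsCrystallographic]

lemma pairingIn_nonpos_of_mem_simpleRootsMult {i j : ι} (hi : i ∈ simpleRootsMult b m)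
    (hj : j ∈ simpleRootsMult b m) (hij : i ≠ j) : P.pairingIn ℤ i j ≤ 0 := by
  by_contra! h
  exact sub_notMem_range_root_of_mem_simpleRootsMult b m hi hj
    (P.root_sub_root_mem_of_pairingIn_pos h hij)

lemma linearIndepOn_simpleRootsMult [P.IsRootSystem] :
    LinearIndepOn ℝ P.root (simpleRootsMult b m) := by
  have := Fintype.ofFinite ι
  refine LinearMap.BilinForm.linearIndependent_of_pairwise_le_zero P.RootForm posDef_rootForm
    (heightFun b) (fun i : simpleRootsMult b m => P.root i) (fun i => ?_) fun i j hij => ?_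
  · rw [heightFun_root]
    exact_mod_cast i.2.1.2
  · have hpairing : (P.pairingIn ℤ i j : ℝ) ≤ 0 := by
      exact_mod_cast pairingIn_nonpos_of_mem_simpleRootsMult b m i.2 j.2
        fun h => hij (Subtype.ext h)
    have hform : 2 * P.RootForm (P.root i) (P.root j) =
        (P.pairingIn ℤ i j : ℝ) * P.RootForm (P.root j) (P.root j) := by
      rw [← pairing_eq_cast_pairingIn]
      exact P.toInvariantForm.two_mul_apply_root_root i j
    linarith [mul_nonpos_of_nonpos_of_nonneg hpairing
      (P.rootForm_self_sum_of_squares (P.root j)).nonneg]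

lemma isBaseOf_simpleRootsMult [P.IsRootSystem] :
    IsBaseOf P (simpleRootsMult b m) (rootsMult b m) := by
  refine ⟨fun i hi => hi.1.1, linearIndepOn_simpleRootsMult b m, fun i hi => ?_⟩
  refine (mem_posRootsMult_or_reflectionPerm_self_mem b m hi).imp
    (root_mem_closure_simpleRootsMult b m) fun h => ?_
  rw [← root_reflectionPerm_self]
  exact root_mem_closure_simpleRootsMult b m h

lemma reflectionPerm_mem_posRootsMult [P.IsReduced] {i j : ι} (hj : j ∈ simpleRootsMult b m)
    (hi : i ∈ posRootsMult b m) (hij : i ≠ j) : P.reflectionPerm j i ∈ posRootsMult b m := by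
  induction hN : (b.height i).toNat using Nat.strong_induction_on generalizing i with
  | _ N ih =>
    have hmem := reflectionPerm_mem_rootsMult b m hi.1 hj.1.1
    have hipos : 0 < b.height i := hi.2
    have hjpos : 0 < b.height j := hj.1.2
    rcases le_or_gt (P.pairingIn ℤ i j) 0 with hpairing | hpairing
    · refine ⟨hmem, ?_⟩
      rw [Base.isPos_iff, height_reflectionPerm]
      nlinarith
    obtain ⟨l, hl⟩ := P.root_sub_root_mem_of_pairingIn_pos hpairing hij
    have hheight := b.height_sub hl
    rcases mem_posRootsMult_or_reflectionPerm_self_mem b m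
      (mem_rootsMult_of_root_eq_sub b m hi.1 hj.1.1 hl) with hlpos | hlneg
    · have hlj : l ≠ j := by
        rintro rfl
        have : IsAddTorsionFree V := .of_isTorsionFree ℝ V
        exact P.nsmul_notMem_range_root (n := 2) (i := l) ⟨i, by rw [two_smul]; grind⟩
      have hrefl := ih _ (by omega) hlpos hlj rfl
      refine (mem_posRootsMult_or_reflectionPerm_self_mem b m hmem).resolve_right fun hneg =>
        hj.2 ⟨_, hrefl, _, hneg, ?_⟩
      rw [root_reflectionPerm_self, root_reflectionPerm, root_reflectionPerm, hl, map_sub,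
        reflection_apply_self]
      abel
    · exact absurd ⟨_, hlneg, i, hi, by rw [root_reflectionPerm_self, hl]; abel⟩ hj.2

end SimpleRootsMult

section HalfSum

lemma sum_erase_reflectionPerm {M : Type*} [AddCommMonoid M] [DecidableEq ι] {Q : Finset ι} {i : ι}
    (hneg : P.reflectionPerm i i ∉ Q) (h : ∀ j ∈ Q, j ≠ i → P.reflectionPerm i j ∈ Q)
    (f : ι → M) : ∑ j ∈ Q.erase i, f (P.reflectionPerm i j) = ∑ j ∈ Q.erase i, f j := by
  have hmaps : ∀ j ∈ Q.erase i, P.reflectionPerm i j ∈ Q.erase i := fun j hj => by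
    obtain ⟨hji, hjQ⟩ := Finset.mem_erase.1 hj
    refine Finset.mem_erase.2 ⟨fun hfix => hneg ?_, h j hjQ hji⟩
    rwa [← P.reflectionPerm_self i j, hfix] at hjQ
  exact Finset.sum_bij' (fun j _ => P.reflectionPerm i j) (fun j _ => P.reflectionPerm i j)
    hmaps hmaps (fun j _ => P.reflectionPerm_self i j) (fun j _ => P.reflectionPerm_self i j)
    fun _ _ => rfl

/-- The reflection in `i` negates the sum of the coroots in `Q` other than that of `i`. -/
lemma root'_halfSumCoroots_eq_one [Fintype ι] {Q : Set ι} {i : ι} (hi : i ∈ Q)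
    (hneg : P.reflectionPerm i i ∉ Q) (h : ∀ j ∈ Q, j ≠ i → P.reflectionPerm i j ∈ Q) :
    P.root' i (halfSumCoroots (P := P) Q) = 1 := by
  classical
  have hsum := sum_erase_reflectionPerm (Q := {j | j ∈ Q}) (by simpa using hneg)
    (by simpa using h) (P.pairing i)
  simp only [pairing_reflectionPerm, pairing_reflectionPerm_self_left, Finset.sum_neg_distrib]
    at hsum
  have htotal : ∑ j with j ∈ Q, P.pairing i j = 2 := by
    rw [← Finset.add_sum_erase _ _ (a := i) (by simpa using hi), pairing_same]
    linarith
  change P.toLinearMap (P.root i) _ = 1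
  simp only [halfSumCoroots, map_smul, map_sum, root_coroot_eq_pairing, smul_eq_mul]
  convert (by norm_num : (1 / 2 : ℝ) * 2 = 1)

end HalfSum

section Levi

lemma subset_generatedSubsystem (I : Set ι) : I ⊆ generatedSubsystem P I :=
  Set.subset_sInter fun _ hS => hS.1

lemma reflectionPerm_mem_generatedSubsystem {I : Set ι} {i j : ι}
    (hi : i ∈ generatedSubsystem P I) (hj : j ∈ generatedSubsystem P I) :
    P.reflectionPerm i j ∈ generatedSubsystem P I :=
  Set.mem_sInter.2 fun S hS => hS.2 i (Set.mem_sInter.1 hi S hS) j (Set.mem_sInter.1 hj S hS)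

lemma root_mem_span_of_mem_generatedSubsystem {I : Set ι} {i : ι}
    (hi : i ∈ generatedSubsystem P I) : P.root i ∈ Submodule.span ℝ (P.root '' I) := by
  refine Set.mem_sInter.1 hi {j | P.root j ∈ Submodule.span ℝ (P.root '' I)}
    ⟨fun j hj => Submodule.subset_span ⟨j, hj, rfl⟩, fun j hj l hl => ?_⟩
  change P.root _ ∈ Submodule.span ℝ (P.root '' I)
  rw [root_reflectionPerm, reflection_apply_root]
  exact sub_mem hl (Submodule.smul_mem _ _ hj)

/-- The coefficients of a root in a base all have the same sign, so no cancellation can occur. -/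
lemma root_mem_span_of_apply_eq_zero (b : P.Base) (φ : V →ₗ[ℝ] ℝ)
    (hφ : ∀ j ∈ b.support, 0 ≤ φ (P.root j)) {i : ι} (hi : φ (P.root i) = 0) :
    P.root i ∈ Submodule.span ℝ (P.root '' {j | j ∈ b.support ∧ φ (P.root j) = 0}) := by
  obtain ⟨f, -, hf⟩ := b.exists_root_eq_sum_nat_or_neg i
  have hsum : ∑ j ∈ b.support, f j • φ (P.root j) = 0 := by
    rcases hf with hf | hf <;> simpa [hf] using hi
  have hterm : ∀ j ∈ b.support, f j • P.root j ∈
      Submodule.span ℝ (P.root '' {j | j ∈ b.support ∧ φ (P.root j) = 0}) := fun j hj => by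
    have hzero := (Finset.sum_eq_zero_iff_of_nonneg
      fun j hj => nsmul_nonneg (hφ j hj) (f j)).1 hsum j hj
    rcases smul_eq_zero.1 hzero with h | h
    · rw [h, zero_smul]
      exact zero_mem _
    · exact Submodule.smul_of_tower_mem _ _ (Submodule.subset_span ⟨j, ⟨hj, h⟩, rfl⟩)
  rcases hf with hf | hf <;> rw [hf]
  · exact sum_mem hterm
  · exact neg_mem (sum_mem hterm)

section

variable [Finite ι] [P.IsRootSystem] [P.IsCrystallographic] [P.IsReduced]

lemma mem_generatedSubsystem_of_isPos (b : P.Base) {I : Set ι} (hI : I ⊆ b.support) {i : ι}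
    (hpos : b.IsPos i) (hi : P.root i ∈ Submodule.span ℝ (P.root '' I)) :
    i ∈ generatedSubsystem P I := by
  induction hN : (b.height i).toNat using Nat.strong_induction_on generalizing i with
  | _ N ih =>
    obtain ⟨j, hj, hpairing⟩ := hpos.exists_mem_support_pos_pairingIn
    rw [P.zero_lt_pairingIn_iff'] at hpairing
    have hjI : j ∈ I := by
      by_contra hjI
      have hcoord := coord_eq_zero_of_mem_span b hI (j := ⟨j, hj⟩) hjI hi
      have hself : b.toWeightBasis.coord ⟨j, hj⟩ (P.root j) = 1 := by
        rw [Module.Basis.coord_apply, b.toWeightBasis_repr_root ⟨j, hj⟩, Finsupp.single_eq_same]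
      rcases eq_or_ne i j with rfl | hij
      · exact one_ne_zero (hself.symm.trans hcoord)
      · have hnonneg := coord_root_nonneg b (hpos.reflectionPerm hj hij) ⟨j, hj⟩
        rw [root_reflectionPerm, reflection_apply_root, map_sub, map_smul, hcoord, hself,
          pairing_eq_cast_pairingIn, smul_eq_mul] at hnonneg
        have : (0 : ℝ) < P.pairingIn ℤ i j := by exact_mod_cast hpairing
        linarith
    rcases eq_or_ne i j with rfl | hij
    · exact subset_generatedSubsystem I hjI
    · have hheight := height_reflectionPerm b i j
      rw [Base.height_one_of_mem_support hj] at hheight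
      have hipos : 0 < b.height i := hpos
      have hrefl := ih _ (by omega) (hpos.reflectionPerm hj hij) (by
        rw [root_reflectionPerm, reflection_apply_root]
        exact sub_mem hi (Submodule.smul_mem _ _ (Submodule.subset_span ⟨j, hjI, rfl⟩))) rfl
      rw [← P.reflectionPerm_self j i]
      exact reflectionPerm_mem_generatedSubsystem (subset_generatedSubsystem I hjI) hrefl

lemma mem_generatedSubsystem_iff (b : P.Base) {I : Set ι} (hI : I ⊆ b.support) {i : ι} :
    i ∈ generatedSubsystem P I ↔ P.root i ∈ Submodule.span ℝ (P.root '' I) := by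
  refine ⟨root_mem_span_of_mem_generatedSubsystem, fun hi => ?_⟩
  rcases Base.IsPos.or_neg b i with hpos | hneg
  · exact mem_generatedSubsystem_of_isPos b hI hpos hi
  · have hmem : P.reflectionPerm i i ∈ generatedSubsystem P I :=
      mem_generatedSubsystem_of_isPos b hI hneg (by
        rw [root_reflectionPerm_self]
        exact neg_mem hi)
    have hinv : P.reflectionPerm (P.reflectionPerm i i) (P.reflectionPerm i i) = i :=
      P.root.injective (by rw [root_reflectionPerm_self, root_reflectionPerm_self, neg_neg])
    exact hinv ▸ reflectionPerm_mem_generatedSubsystem hmem hmem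

lemma IsLeviType.mem_of_mem_span {b : P.Base} {Q : Set ι} (hQ : IsLeviType b Q) {i : ι}
    (hi : P.root i ∈ Submodule.span ℝ (P.root '' Q)) : i ∈ Q := by
  obtain ⟨w, I, hI, rfl⟩ := hQ
  refine ⟨P.weylGroupToPerm w⁻¹ i, ?_, by
    simp only [map_inv, Equiv.Perm.coe_inv, Equiv.apply_symm_apply]⟩
  rw [mem_generatedSubsystem_iff b hI, ← weylGroup_apply_root]
  have hmap := Submodule.mem_map_of_mem (f := (DistribSMul.toLinearMap ℝ V w⁻¹ : V →ₗ[ℝ] V)) hi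
  rw [Submodule.map_span] at hmap
  refine Submodule.span_le.2 ?_ hmap
  rintro _ ⟨_, ⟨_, ⟨j, hj, rfl⟩, rfl⟩, rfl⟩
  rw [DistribSMul.toLinearMap_apply, ← weylGroup_apply_root, inv_smul_smul]
  exact root_mem_span_of_mem_generatedSubsystem hj

end

variable [Finite ι] [P.IsCrystallographic] [P.IsReduced]

/-- Choose `w` maximizing the pairing of `φ` with the image of the sum of the positive roots. -/
lemma exists_weylGroup_dominant (b : P.Base) (φ : N) :
    ∃ w : P.weylGroup, ∀ i ∈ b.support, 0 ≤ P.root' (P.weylGroupToPerm w i) φ := by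
  classical
  have := Fintype.ofFinite ι
  let Q : Finset ι := {j | b.IsPos j}
  obtain ⟨_, ⟨w, rfl⟩, hw⟩ := Set.exists_max_image (Set.range P.weylGroupToPerm)
    (fun g => ∑ j ∈ Q, P.root' (g j) φ) (Set.toFinite _) ⟨_, 1, rfl⟩
  refine ⟨w, fun i hi => ?_⟩
  have hipos := Base.isPos_of_mem_support hi
  have hmax := hw _ ⟨w * weylGroup.ofIdx P i, rfl⟩
  have hofIdx : P.weylGroupToPerm (weylGroup.ofIdx P i) = P.reflectionPerm i := by
    simp [weylGroup.ofIdx]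
  have hneg : P.root' (P.weylGroupToPerm w (P.reflectionPerm i i)) φ =
      -P.root' (P.weylGroupToPerm w i) φ := by
    change P.toLinearMap (P.root _) φ = -P.toLinearMap (P.root _) φ
    rw [← weylGroup_apply_root, ← weylGroup_apply_root, root_reflectionPerm_self, smul_neg,
      map_neg, LinearMap.neg_apply]
  have hiQ : i ∈ Q := by simpa [Q] using hipos
  simp only [map_mul, hofIdx, Equiv.Perm.mul_apply] at hmax
  rw [← Finset.add_sum_erase _ _ hiQ, ← Finset.add_sum_erase _ _ hiQ,
    sum_erase_reflectionPerm (by simpa [Q] using not_isPos_reflectionPerm_self hipos)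
      (by simpa [Q] using fun j hj hji => hj.reflectionPerm hi hji)
      fun j => P.root' (P.weylGroupToPerm w j) φ, hneg] at hmax
  linarith

lemma isLeviType_setOf_root'_eq_zero [P.IsRootSystem] (b : P.Base) (φ : N) :
    IsLeviType b {i | P.root' i φ = 0} := by
  obtain ⟨w, hw⟩ := exists_weylGroup_dominant b φ
  let ψ : V →ₗ[ℝ] ℝ := P.toLinearMap.flip φ ∘ₗ DistribSMul.toLinearMap ℝ V w
  have hψ (i) : ψ (P.root i) = P.root' (P.weylGroupToPerm w i) φ := by
    change P.toLinearMap (w • P.root i) φ = _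
    rw [weylGroup_apply_root]
  let I : Set ι := {j | j ∈ b.support ∧ ψ (P.root j) = 0}
  have hgen (i) : i ∈ generatedSubsystem P I ↔ ψ (P.root i) = 0 := by
    rw [mem_generatedSubsystem_iff b fun j hj => hj.1]
    refine ⟨fun h => ?_, root_mem_span_of_apply_eq_zero b ψ fun j hj => hψ j ▸ hw j hj⟩
    suffices Submodule.span ℝ (P.root '' I) ≤ LinearMap.ker ψ from this h
    rw [Submodule.span_le]
    rintro _ ⟨j, hj, rfl⟩
    exact hj.2
  refine ⟨w, I, fun j hj => hj.1, Set.ext fun i => ?_⟩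
  rw [Equiv.image_eq_preimage_symm, Set.mem_preimage, hgen, hψ, Equiv.apply_symm_apply,
    Set.mem_ofPred_eq]

end Levi

end

/-! ### Families of vectors with a given Cartan matrix -/

section Represents

variable {E : Type*} [AddCommGroup E] [Module ℝ E]

/-- The squared length of `ε_0`, which is `0` in type `B_n`: there `ε_0` stands for the zero vector,
so that `α_1 = ε_1 - ε_0` in both families. -/
def Family.sq : Family → ℝ
  | .B => 0
  | .D => 1

/-- The squared lengths of `ε_0, ε_1, …`. -/
def Family.sqLength (X : Family) (a : ℕ) : ℝ := if a = 0 then X.sq else 1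

/-- The vectors `v` have the Cartan matrix `A` with respect to the form `g`. The condition is
written without division, so that it makes sense for vectors of length `0`. -/
def Represents (g : E →ₗ[ℝ] E →ₗ[ℝ] ℝ) {κ : Type} (v : κ → E) (A : Matrix κ κ ℤ) : Prop :=
  ∀ x y, 2 * g (v x) (v y) = A x y * g (v y) (v y)

/-- The vectors `u 0, …, u q` are pairwise orthogonal for `g`, and `w` gives their squared
lengths. -/
def OrthogonalUpTo (g : E →ₗ[ℝ] E →ₗ[ℝ] ℝ) (u : ℕ → E) (q : ℕ) (w : ℕ → ℝ) : Prop :=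
  ∀ a b, a ≤ q → b ≤ q → g (u a) (u b) = if a = b then w a else 0

/-- The standard simple roots of the diagram `B_q` or `D_{q+1}` in terms of `u = (ε_0, ε_1, …)`,
in the order of the rows of `Family.BD`. -/
def chainVec (X : Family) (u : ℕ → E) (q : ℕ) (x : Fin (X.rank q)) : E :=
  if (x : ℕ) = q then u 1 + u 0 else u (q - x) - u (q - x - 1)

/-- The standard simple roots of the diagram `A_l` in terms of `u = (ε_0, ε_1, …)`. -/
def stepVec (u : ℕ → E) (l : ℕ) (x : Fin l) : E := u (x + 1) - u x

variable {g : E →ₗ[ℝ] E →ₗ[ℝ] ℝ} {u : ℕ → E} {q : ℕ} {w : ℕ → ℝ}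

lemma OrthogonalUpTo.apply_sub_sub (hu : OrthogonalUpTo g u q w) {i j : ℕ} (hi : i < q)
    (hj : j < q) : g (u (i + 1) - u i) (u (j + 1) - u j) =
      if i = j then w (i + 1) + w i else if i = j + 1 then -w i
        else if j = i + 1 then -w j else 0 := by
  simp only [map_sub, LinearMap.sub_apply]
  rw [hu _ _ (by omega) (by omega), hu _ _ (by omega) (by omega), hu _ _ (by omega) (by omega),
    hu _ _ (by omega) (by omega)]
  grind

lemma OrthogonalUpTo.represents_stepVec (hu : OrthogonalUpTo g u q 1) :
    Represents g (stepVec u q) (typeA q) := by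
  intro x y
  rw [stepVec, stepVec, hu.apply_sub_sub x.2 y.2, hu.apply_sub_sub y.2 y.2]
  simp only [CartanMatrix.A, Matrix.of_apply, Fin.ext_iff, Pi.one_apply]
  split_ifs <;> first | omega | norm_num

lemma BD_B_apply (q : ℕ) (x y : Fin q) : Family.B.BD q x y =
    if (x : ℕ) = y then 2 else if (x : ℕ) + 1 = y then if (y : ℕ) + 1 = q then -2 else -1
      else if (y : ℕ) + 1 = x then -1 else 0 := by
  simp only [Family.BD, CartanMatrix.B, Fin.ext_iff, Matrix.of_apply]
  grind

lemma BD_D_apply (q : ℕ) (x y : Fin (q + 1)) : Family.D.BD q x y =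
    if (x : ℕ) = y then 2
    else if (x : ℕ) = q then if (y : ℕ) + 2 = q then -1 else 0
    else if (y : ℕ) = q then if (x : ℕ) + 2 = q then -1 else 0
    else if (x : ℕ) + 1 = y ∨ (y : ℕ) + 1 = x then -1 else 0 := by
  simp only [Family.BD, CartanMatrix.D, Fin.ext_iff, Matrix.of_apply]
  split_ifs <;> first | rfl | omega

lemma OrthogonalUpTo.apply_chain_chain {X : Family} (hu : OrthogonalUpTo g u q X.sqLength)
    {x y : ℕ} (hx : x < q) (hy : y < q) :
    g (u (q - x) - u (q - x - 1)) (u (q - y) - u (q - y - 1)) =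
      if x = y then if x + 1 = q then 1 + X.sq else 2
        else if x + 1 = y ∨ y + 1 = x then -1 else 0 := by
  obtain ⟨i, hi⟩ : ∃ i, q - x = i + 1 := ⟨q - x - 1, by omega⟩
  obtain ⟨j, hj⟩ : ∃ j, q - y = j + 1 := ⟨q - y - 1, by omega⟩
  rw [hi, hj, Nat.add_sub_cancel, Nat.add_sub_cancel, hu.apply_sub_sub (by omega) (by omega)]
  simp only [Family.sqLength]
  grind

lemma OrthogonalUpTo.represents_chainVec_B (hu : OrthogonalUpTo g u q Family.B.sqLength) :
    Represents g (chainVec .B u q) (Family.B.BD q) := by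
  intro x y
  have hx : (x : ℕ) < q := x.2
  have hy : (y : ℕ) < q := y.2
  rw [chainVec, chainVec, if_neg hx.ne, if_neg hy.ne, hu.apply_chain_chain hx hy,
    hu.apply_chain_chain hy hy, BD_B_apply q x y, Family.sq]
  split_ifs <;> first | omega | norm_num

lemma OrthogonalUpTo.apply_fork_fork (hq : 1 ≤ q) (hu : OrthogonalUpTo g u q Family.D.sqLength) :
    g (u 1 + u 0) (u 1 + u 0) = 2 := by
  simp only [map_add, LinearMap.add_apply]
  rw [hu _ _ (by omega) (by omega), hu _ _ (by omega) (by omega), hu _ _ (by omega) (by omega),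
    hu _ _ (by omega) (by omega)]
  norm_num [Family.sqLength, Family.sq]

lemma OrthogonalUpTo.apply_fork_chain (hu : OrthogonalUpTo g u q Family.D.sqLength) {y : ℕ}
    (hy : y < q) :
    g (u 1 + u 0) (u (q - y) - u (q - y - 1)) = if y + 2 = q then -1 else 0 := by
  simp only [map_add, map_sub, LinearMap.add_apply]
  rw [hu _ _ (by omega) (by omega), hu _ _ (by omega) (by omega), hu _ _ (by omega) (by omega),
    hu _ _ (by omega) (by omega)]
  simp only [Family.sqLength, Family.sq]
  grind

lemma OrthogonalUpTo.apply_chain_fork (hu : OrthogonalUpTo g u q Family.D.sqLength) {x : ℕ}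
    (hx : x < q) :
    g (u (q - x) - u (q - x - 1)) (u 1 + u 0) = if x + 2 = q then -1 else 0 := by
  simp only [map_add, map_sub, LinearMap.sub_apply]
  rw [hu _ _ (by omega) (by omega), hu _ _ (by omega) (by omega), hu _ _ (by omega) (by omega),
    hu _ _ (by omega) (by omega)]
  simp only [Family.sqLength, Family.sq]
  grind

lemma OrthogonalUpTo.represents_chainVec_D (hq : 1 ≤ q)
    (hu : OrthogonalUpTo g u q Family.D.sqLength) :
    Represents g (chainVec .D u q) (Family.D.BD q) := by
  intro x y
  have hx : (x : ℕ) < q + 1 := x.2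
  have hy : (y : ℕ) < q + 1 := y.2
  have hchain {z : ℕ} (hz : z < q) :
      g (u (q - z) - u (q - z - 1)) (u (q - z) - u (q - z - 1)) = 2 := by
    rw [hu.apply_chain_chain hz hz, Family.sq, if_pos rfl, one_add_one_eq_two, ite_self]
  rw [BD_D_apply q x y, chainVec, chainVec]
  by_cases hxq : (x : ℕ) = q <;> by_cases hyq : (y : ℕ) = q
  · simp [hxq, hyq]
  · have hxy : (x : ℕ) ≠ y := by omega
    rw [if_pos hxq, if_neg hyq, if_neg hxy, if_pos hxq, hu.apply_fork_chain (by omega),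
      hchain (by omega)]
    split_ifs <;> norm_num
  · have hxy : (x : ℕ) ≠ y := by omega
    rw [if_neg hxq, if_pos hyq, if_neg hxy, if_neg hxq, if_pos hyq,
      hu.apply_chain_fork (by omega), hu.apply_fork_fork hq]
    split_ifs <;> norm_num
  · rw [if_neg hxq, if_neg hyq, if_neg hxq, if_neg hyq, hu.apply_chain_chain (by omega) (by omega),
      hchain (by omega), Family.sq]
    split_ifs <;> norm_num

lemma OrthogonalUpTo.represents_chainVec {X : Family} (hq : 1 ≤ q)
    (hu : OrthogonalUpTo g u q X.sqLength) : Represents g (chainVec X u q) (X.BD q) := by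
  cases X
  · exact hu.represents_chainVec_B
  · exact hu.represents_chainVec_D hq

lemma Represents.sum {κ κ' : Type} {v : κ → E} {v' : κ' → E} {A : Matrix κ κ ℤ}
    {B : Matrix κ' κ' ℤ} (hv : Represents g v A) (hv' : Represents g v' B)
    (h : ∀ x y, g (v x) (v' y) = 0) (h' : ∀ x y, g (v' y) (v x) = 0) :
    Represents g (Sum.elim v v') (A ⊕ᴅ B) := by
  rintro (x | x) (y | y)
  · exact hv x y
  · simp [diagramSum, h]
  · simp [diagramSum, h']
  · exact hv' x y

lemma represents_copies {κ : Type} {c : ℕ} {v : Fin c → κ → E} {A : Matrix κ κ ℤ}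
    (hv : ∀ s, Represents g (v s) A) (h : ∀ s s' x y, s ≠ s' → g (v s x) (v s' y) = 0) :
    Represents g (fun z : κ × Fin c => v z.2 z.1) (copies c A) := by
  rintro ⟨x, s⟩ ⟨y, s'⟩
  rcases eq_or_ne s s' with rfl | hs
  · simpa [copies] using hv s x y
  · simp [copies, Matrix.blockDiagonal_apply, hs, h s s' x y hs]

/-- The off-diagonal entries of `A` are nonpositive, as in a Cartan matrix. -/
def OffDiagNonpos {κ : Type} (A : Matrix κ κ ℤ) : Prop := ∀ x y, x ≠ y → A x y ≤ 0

lemma OffDiagNonpos.sum {κ κ' : Type} {A : Matrix κ κ ℤ} {B : Matrix κ' κ' ℤ}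
    (hA : OffDiagNonpos A) (hB : OffDiagNonpos B) : OffDiagNonpos (A ⊕ᴅ B) := by
  rintro (x | x) (y | y) h
  · exact hA x y fun hxy => h (congrArg _ hxy)
  · exact le_rfl
  · exact le_rfl
  · exact hB x y fun hxy => h (congrArg _ hxy)

lemma OffDiagNonpos.copies {κ : Type} {A : Matrix κ κ ℤ} (hA : OffDiagNonpos A) (c : ℕ) :
    OffDiagNonpos (copies c A) := by
  rintro ⟨x, s⟩ ⟨y, s'⟩ h
  rw [HeightSubsystem.copies, Matrix.blockDiagonal_apply]
  split_ifs with hs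
  · exact hA x y fun hxy => h (Prod.ext hxy hs)
  · exact le_rfl

lemma offDiagNonpos_A (l : ℕ) : OffDiagNonpos (typeA l) :=
  CartanMatrix.A_apply_le_zero_of_ne l

lemma offDiagNonpos_BD (X : Family) (q : ℕ) : OffDiagNonpos (X.BD q) := by
  cases X
  · exact CartanMatrix.B_off_diag_nonpos q
  · exact CartanMatrix.D_off_diag_nonpos (q + 1)

end Represents

/-! ### The standard realization -/

section Realization

lemma Family.sq_eq_zero_or_one (X : Family) : X.sq = 0 ∨ X.sq = 1 := by
  cases X
  · exact .inl rfl
  · exact .inr rfl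

lemma Family.sqLength_zero (X : Family) : X.sqLength 0 = X.sq := if_pos rfl

lemma Family.sqLength_of_pos (X : Family) {a : ℕ} (ha : 0 < a) : X.sqLength a = 1 :=
  if_neg ha.ne'

lemma Family.sqLength_D : Family.D.sqLength = 1 :=
  funext fun a => ite_self (1 : ℝ) (c := a = 0)

lemma Family.sqLength_mul_self (X : Family) (a : ℕ) :
    X.sqLength a * X.sqLength a = X.sqLength a := by
  rcases Nat.eq_zero_or_pos a with rfl | ha
  · rcases X.sq_eq_zero_or_one with h | h <;> rw [X.sqLength_zero, h] <;> norm_num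
  · rw [X.sqLength_of_pos ha, mul_one]

lemma Family.le_rank (X : Family) (n : ℕ) : n ≤ X.rank n := by
  cases X
  · exact le_rfl
  · exact n.le_succ

lemma Family.rank_le (X : Family) (n : ℕ) : X.rank n ≤ n + 1 := by
  cases X
  · exact n.le_succ
  · exact le_rfl

lemma Family.sq_eq_one_of_lt_rank {X : Family} {n : ℕ} (h : n < X.rank n) : X.sq = 1 := by
  cases X
  · exact absurd h (lt_irrefl n)
  · rfl

lemma Family.lt_rank_of_sq_eq_one {X : Family} (hX : X.sq = 1) (n : ℕ) : n < X.rank n := by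
  cases X
  · exact absurd hX zero_ne_one
  · exact n.lt_succ_self

/-- The standard scalar product of finitely supported sequences. -/
noncomputable def dotForm : (ℕ →₀ ℝ) →ₗ[ℝ] (ℕ →₀ ℝ) →ₗ[ℝ] ℝ :=
  Finsupp.lsum ℝ fun a => LinearMap.toSpanSingleton ℝ _ (Finsupp.lapply a)

lemma dotForm_single (a c : ℕ) (s t : ℝ) :
    dotForm (Finsupp.single a s) (Finsupp.single c t) = if a = c then s * t else 0 := by
  simp [dotForm, Finsupp.single_apply, eq_comm]

lemma dotForm_comm (v w : ℕ →₀ ℝ) : dotForm v w = dotForm w v := by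
  suffices dotForm = dotForm.flip from LinearMap.congr_fun₂ this v w
  refine Finsupp.lhom_ext fun a s => Finsupp.lhom_ext fun c t => ?_
  rw [LinearMap.flip_apply, dotForm_single, dotForm_single, mul_comm]
  simp only [eq_comm]

/-- The coordinates of `ε_a`. -/
noncomputable def unitVec (X : Family) (a : ℕ) : ℕ →₀ ℝ := Finsupp.single a (X.sqLength a)

lemma orthogonalUpTo_unitVec (X : Family) (n : ℕ) :
    OrthogonalUpTo dotForm (unitVec X) n X.sqLength := by
  intro a c _ _
  rw [unitVec, unitVec, dotForm_single]
  split_ifs with hac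
  · rw [← hac, X.sqLength_mul_self]
  · rfl

variable {ι V N : Type*} [AddCommGroup V] [Module ℝ V] [AddCommGroup N] [Module ℝ N]
  {P : RootPairing ι ℝ V N} {b : P.Base}

section SimpleRoot

variable {X : Family} {n : ℕ} (e : Fin (X.rank n) ≃ b.support)

lemma simpleRoot_eq_root {j : ℕ} (hj : j ≤ n) (h : n - j < X.rank n) :
    simpleRoot X n e j = P.root (e ⟨n - j, h⟩) :=
  dif_pos ⟨hj, h⟩

lemma sub_lt_rank (X : Family) {n j : ℕ} (hj : 1 ≤ j) (hjn : j ≤ n) : n - j < X.rank n :=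
  (Nat.sub_lt (by omega) hj).trans_le (X.le_rank n)

lemma exists_root_eq_simpleRoot {j : ℕ} (hj : 1 ≤ j) (hjn : j ≤ n) :
    ∃ i ∈ b.support, P.root i = simpleRoot X n e j :=
  ⟨_, (e _).2, (simpleRoot_eq_root e hjn (sub_lt_rank X hj hjn)).symm⟩

lemma exists_root_eq_simpleRoot_zero (hX : X.sq = 1) :
    ∃ i ∈ b.support, P.root i = simpleRoot X n e 0 :=
  ⟨_, (e _).2, (simpleRoot_eq_root e n.zero_le (Family.lt_rank_of_sq_eq_one hX n)).symm⟩

lemma root_eq_simpleRoot_of_mem_support {i : ι} (hi : i ∈ b.support) :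
    (∃ j, 1 ≤ j ∧ j ≤ n ∧ P.root i = simpleRoot X n e j) ∨
      X.sq = 1 ∧ P.root i = simpleRoot X n e 0 := by
  obtain ⟨x, hx⟩ := e.surjective ⟨i, hi⟩
  have hrank := X.rank_le n
  have hj : n - (n - (x : ℕ)) = x := by omega
  have hroot : P.root i = simpleRoot X n e (n - x) := by
    rw [simpleRoot_eq_root e (Nat.sub_le _ _) (by omega)]
    simp only [hj, Fin.eta, hx]
  rcases Nat.eq_zero_or_pos (n - x) with h | h
  · exact .inr ⟨Family.sq_eq_one_of_lt_rank (n := n) (by omega), h ▸ hroot⟩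
  · exact .inl ⟨_, h, Nat.sub_le _ _, hroot⟩

variable (X n)

/-- The vector `ε_a` in terms of the simple roots; note that `α_0 - α_1 = 2 ε_0` in type `D`. -/
noncomputable def eps (a : ℕ) : V :=
  (X.sq / 2) • (simpleRoot X n e 0 - simpleRoot X n e 1) +
    ∑ j ∈ Finset.Icc 1 a, simpleRoot X n e j

lemma eps_succ (a : ℕ) : eps X n e (a + 1) = eps X n e a + simpleRoot X n e (a + 1) := by
  rw [eps, eps, Finset.sum_Icc_succ_top (by omega), add_assoc]

lemma simpleRoot_eq_eps_sub {j : ℕ} (hj : 1 ≤ j) :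
    simpleRoot X n e j = eps X n e j - eps X n e (j - 1) := by
  obtain ⟨a, rfl⟩ := Nat.exists_eq_add_of_le' hj
  rw [eps_succ, Nat.add_sub_cancel, add_sub_cancel_left]

lemma simpleRoot_zero_eq_eps_add (hX : X.sq = 1) :
    simpleRoot X n e 0 = eps X n e 1 + eps X n e 0 := by
  rw [eps_succ, eps, hX, Finset.Icc_eq_empty (by norm_num), Finset.sum_empty]
  module

lemma eps_zero_of_sq (hX : X.sq = 0) : eps X n e 0 = 0 := by
  rw [eps, hX, zero_div, zero_smul, Finset.Icc_eq_empty (by norm_num), Finset.sum_empty, add_zero]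

variable {X n}

lemma map_eps {E : Type*} [AddCommGroup E] [Module ℝ E] (f : V →ₗ[ℝ] E) (u : ℕ → E) (hn : 1 ≤ n)
    (hsucc : ∀ j, 1 ≤ j → j ≤ n → f (simpleRoot X n e j) = u j - u (j - 1))
    (hadd : X.sq = 1 → f (simpleRoot X n e 0) = u 1 + u 0) (hzero : X.sq = 0 → u 0 = 0) {a : ℕ}
    (ha : a ≤ n) : f (eps X n e a) = u a := by
  induction a with
  | zero =>
    rcases X.sq_eq_zero_or_one with hX | hX
    · rw [eps_zero_of_sq X n e hX, map_zero, hzero hX]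
    · rw [eps, Finset.Icc_eq_empty (by norm_num), Finset.sum_empty, add_zero, map_smul, map_sub,
        hadd hX, hsucc 1 le_rfl hn, hX, Nat.sub_self]
      module
  | succ a ih =>
    rw [eps_succ, map_add, ih (by omega), hsucc _ (by omega) ha, Nat.add_sub_cancel]
    abel

end SimpleRoot

section StdForm

variable [P.IsRootSystem] {X : Family} {n : ℕ} (e : Fin (X.rank n) ≃ b.support)

lemma heightFun_eps (hn : 1 ≤ n) {a : ℕ} (ha : a ≤ n) : heightFun b (eps X n e a) = a := by
  refine map_eps e (heightFun b) (fun a => (a : ℝ)) hn (fun j hj hjn => ?_) (fun hX => ?_)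
    (fun _ => Nat.cast_zero) ha
  · obtain ⟨i, hi, hroot⟩ := exists_root_eq_simpleRoot e hj hjn
    rw [← hroot, heightFun_root_of_mem_support b hi, Nat.cast_sub hj, Nat.cast_one, sub_sub_cancel]
  · obtain ⟨i, hi, hroot⟩ := exists_root_eq_simpleRoot_zero e hX
    rw [← hroot, heightFun_root_of_mem_support b hi, Nat.cast_one, Nat.cast_zero, add_zero]

variable (X n)

/-- The coordinates of a vector with respect to `ε_0, …, ε_n`. -/
noncomputable def coordMap : V →ₗ[ℝ] (ℕ →₀ ℝ) :=
  b.toWeightBasis.constr ℝ fun s => chainVec X (unitVec X) n (e.symm s)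

/-- The scalar product for which the `ε_a` are orthogonal. -/
noncomputable def stdForm : V →ₗ[ℝ] V →ₗ[ℝ] ℝ :=
  dotForm.compl₁₂ (coordMap X n e) (coordMap X n e)

variable {X n}

lemma coordMap_root (x : Fin (X.rank n)) :
    coordMap X n e (P.root (e x)) = chainVec X (unitVec X) n x := by
  rw [← b.toWeightBasis_apply, coordMap, Module.Basis.constr_basis, Equiv.symm_apply_apply]

lemma coordMap_eps (hn : 1 ≤ n) {a : ℕ} (ha : a ≤ n) :
    coordMap X n e (eps X n e a) = unitVec X a := by
  refine map_eps e _ _ hn (fun j hj hjn => ?_) (fun hX => ?_) (fun hX => ?_) ha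
  · rw [simpleRoot_eq_root e hjn (sub_lt_rank X hj hjn), coordMap_root, chainVec,
      if_neg (by simp only; omega)]
    simp only [Nat.sub_sub_self hjn]
  · rw [simpleRoot_eq_root e n.zero_le (Family.lt_rank_of_sq_eq_one hX n), coordMap_root, chainVec,
      if_pos n.sub_zero]
  · rw [unitVec, X.sqLength_zero, hX, Finsupp.single_zero]

lemma orthogonalUpTo_eps (hn : 1 ≤ n) :
    OrthogonalUpTo (stdForm X n e) (eps X n e) n X.sqLength := by
  intro a c ha hc
  rw [stdForm, LinearMap.compl₁₂_apply, coordMap_eps e hn ha, coordMap_eps e hn hc,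
    orthogonalUpTo_unitVec X n a c ha hc]

lemma stdForm_comm (v w : V) : stdForm X n e v w = stdForm X n e w v :=
  dotForm_comm _ _

variable [P.IsCrystallographic] {e} (hn : 1 ≤ n)
  (he : ∀ x y, b.cartanMatrix (e x) (e y) = X.BD n x y)

include hn he

lemma coroot'_mul_stdForm_of_mem_support {s : ι} (hs : s ∈ b.support) (v : V) :
    P.coroot' s v * stdForm X n e (P.root s) (P.root s) = 2 * stdForm X n e v (P.root s) := by
  obtain ⟨x, hx⟩ := e.surjective ⟨s, hs⟩
  obtain rfl : (e x : ι) = s := by rw [hx]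
  suffices h : (stdForm X n e (P.root (e x)) (P.root (e x))) • P.coroot' (e x) =
      (2 : ℝ) • (stdForm X n e).flip (P.root (e x)) by
    rw [mul_comm]
    exact LinearMap.congr_fun h v
  refine b.toWeightBasis.ext fun t => ?_
  obtain ⟨y, rfl⟩ := e.surjective t
  have hrep := (orthogonalUpTo_unitVec X n).represents_chainVec hn y x
  have hpairing : P.pairing (e y) (e x) = (X.BD n y x : ℝ) := by
    rw [← he, Base.cartanMatrix, Base.cartanMatrixIn_def, pairing_eq_cast_pairingIn]
  rw [Base.toWeightBasis_apply, LinearMap.smul_apply, LinearMap.smul_apply, LinearMap.flip_apply,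
    LinearMap.flip_apply, root_coroot_eq_pairing, hpairing, smul_eq_mul, smul_eq_mul, stdForm,
    LinearMap.compl₁₂_apply, LinearMap.compl₁₂_apply, coordMap_root, coordMap_root, hrep, mul_comm]

lemma stdForm_reflection_of_mem_support {s : ι} (hs : s ∈ b.support) (v w : V) :
    stdForm X n e (P.reflection s v) (P.reflection s w) = stdForm X n e v w := by
  have hv := coroot'_mul_stdForm_of_mem_support hn he hs v
  have hw := coroot'_mul_stdForm_of_mem_support hn he hs w
  rw [stdForm_comm e w] at hw
  simp only [reflection_apply, map_sub, map_smul, LinearMap.sub_apply, LinearMap.smul_apply,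
    smul_eq_mul]
  linear_combination (P.coroot' s w / 2) * hv + (P.coroot' s v / 2) * hw

lemma coroot'_mul_stdForm [Finite ι] [P.IsReduced] (i : ι) (v : V) :
    P.coroot' i v * stdForm X n e (P.root i) (P.root i) = 2 * stdForm X n e v (P.root i) := by
  revert v
  refine Base.induction_reflect (b := b) i (p := fun i => ∀ v,
    P.coroot' i v * stdForm X n e (P.root i) (P.root i) = 2 * stdForm X n e v (P.root i))
    (fun i ih v => ?_) (fun s hs v => coroot'_mul_stdForm_of_mem_support hn he hs v)
    (fun i s ih hs v => ?_)
  · have hneg : P.coroot' (P.reflectionPerm i i) v = -P.coroot' i v := by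
      rw [coroot', coroot_reflectionPerm, coreflection_apply_self, map_neg, LinearMap.neg_apply]
    rw [root_reflectionPerm_self, hneg, map_neg, map_neg, LinearMap.neg_apply, neg_neg, neg_mul,
      ih v, map_neg, mul_neg]
  · rw [root_reflectionPerm, stdForm_reflection_of_mem_support hn he hs, coroot'_reflectionPerm,
      ← stdForm_reflection_of_mem_support hn he hs v, reflection_same]
    exact ih (P.reflection s v)

end StdForm

end Realization

section Realization

variable {ι V N : Type*} [AddCommGroup V] [Module ℝ V] [AddCommGroup N] [Module ℝ N]
  {P : RootPairing ι ℝ V N} {b : P.Base} [P.IsRootSystem]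

/-- The vectors `ε_0, …, ε_n` and the scalar product `g` realize the root system with base `b` in
the standard way. In type `B_n`, where the coordinates start with `ε_1`, the vector `ε_0` is `0`. -/
structure Realization (X : Family) (n : ℕ) (e : Fin (X.rank n) ≃ b.support) (ε : ℕ → V)
    (g : V →ₗ[ℝ] V →ₗ[ℝ] ℝ) : Prop where
  one_le : 1 ≤ n
  form_eps : OrthogonalUpTo g ε n X.sqLength
  form_comm : ∀ v w, g v w = g w v
  coroot'_mul : ∀ i v, P.coroot' i v * g (P.root i) (P.root i) = 2 * g v (P.root i)
  height_eps : ∀ a ≤ n, heightFun b (ε a) = a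
  eps_zero : X.sq = 0 → ε 0 = 0
  simple_succ : ∀ j, 1 ≤ j → j ≤ n → simpleRoot X n e j = ε j - ε (j - 1)
  simple_zero : X.sq = 1 → simpleRoot X n e 0 = ε 1 + ε 0

lemma realization_eps [Finite ι] [P.IsCrystallographic] [P.IsReduced] {X : Family} {n : ℕ}
    {e : Fin (X.rank n) ≃ b.support} (hn : 1 ≤ n)
    (he : ∀ x y, b.cartanMatrix (e x) (e y) = X.BD n x y) :
    Realization X n e (eps X n e) (stdForm X n e) where
  one_le := hn
  form_eps := orthogonalUpTo_eps e hn
  form_comm := stdForm_comm e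
  coroot'_mul := coroot'_mul_stdForm hn he
  height_eps _ := heightFun_eps e hn
  eps_zero := eps_zero_of_sq X n e
  simple_succ _ hj _ := simpleRoot_eq_eps_sub X n e hj
  simple_zero := simpleRoot_zero_eq_eps_add X n e

namespace Realization

variable {X : Family} {n : ℕ} {e : Fin (X.rank n) ≃ b.support} {ε : ℕ → V}
  {g : V →ₗ[ℝ] V →ₗ[ℝ] ℝ} (hR : Realization X n e ε g)

include hR

lemma pairing_mul (i j : ι) :
    P.pairing i j * g (P.root j) (P.root j) = 2 * g (P.root i) (P.root j) := by
  rw [← root_coroot_eq_pairing]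
  exact hR.coroot'_mul j (P.root i)

lemma form_self_smul_add_smul {a c : ℕ} {x y : ℝ} (ha : a ≤ n) (hc : c ≤ n) (hac : a ≠ c) :
    g (x • ε c + y • ε a) (x • ε c + y • ε a) =
      x * x * X.sqLength c + y * y * X.sqLength a := by
  simp only [map_add, map_smul, LinearMap.add_apply, LinearMap.smul_apply, smul_eq_mul,
    hR.form_eps _ _ ha ha, hR.form_eps _ _ ha hc, hR.form_eps _ _ hc ha, hR.form_eps _ _ hc hc,
    if_neg hac, if_neg hac.symm, ↓reduceIte]
  ring

lemma reflection_eps_of_long {i : ι} {a c d : ℕ} {x y : ℝ}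
    (hi : P.root i = x • ε c + y • ε a) (ha : a ≤ n) (hc : c ≤ n) (hd : d ≤ n) (hac : a ≠ c)
    (hx : x * x = 1) (hy : y * y = 1) (hla : X.sqLength a = 1) (hlc : X.sqLength c = 1) :
    P.reflection i (ε d) =
      if d = c then -(x * y) • ε a else if d = a then -(x * y) • ε c else ε d := by
  have hcoroot := hR.coroot'_mul i (ε d)
  rw [hi, hR.form_self_smul_add_smul ha hc hac, hla, hlc, hx, hy, map_add, map_smul, map_smul,
    hR.form_eps _ _ hd hc, hR.form_eps _ _ hd ha] at hcoroot
  rw [reflection_apply, hi]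
  split_ifs with hdc hda
  · rw [if_pos hdc, if_neg (by omega), hdc, hlc] at hcoroot
    rw [hdc, show P.coroot' i (ε c) = x by linear_combination hcoroot / 2]
    rw [smul_add, smul_smul, hx]
    module
  · rw [if_neg hdc, if_pos hda, hda, hla] at hcoroot
    rw [hda, show P.coroot' i (ε a) = y by linear_combination hcoroot / 2]
    rw [smul_add, smul_smul y y, hy]
    module
  · rw [if_neg hdc, if_neg hda] at hcoroot
    rw [show P.coroot' i (ε d) = 0 by linear_combination hcoroot / 2, zero_smul, sub_zero]

lemma reflection_eps_of_short {i : ι} {c d : ℕ} (hi : P.root i = ε c) (hc : c ≤ n) (hd : d ≤ n)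
    (hlc : X.sqLength c = 1) : P.reflection i (ε d) = if d = c then -ε c else ε d := by
  have hcoroot := hR.coroot'_mul i (ε d)
  rw [hi, hR.form_eps _ _ hc hc, if_pos rfl, hlc, hR.form_eps _ _ hd hc, mul_one] at hcoroot
  rw [reflection_apply, hcoroot, hi]
  split_ifs with hdc
  · rw [hdc, hlc]
    module
  · rw [mul_zero, zero_smul, sub_zero]

lemma root_of_mem_support {s : ι} (hs : s ∈ b.support) :
    (∃ j, 1 ≤ j ∧ j ≤ n ∧ P.root s = ε j - ε (j - 1)) ∨ X.sq = 1 ∧ P.root s = ε 1 + ε 0 := by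
  rcases root_eq_simpleRoot_of_mem_support e hs with ⟨j, hj, hjn, h⟩ | ⟨hX, h⟩
  · exact .inl ⟨j, hj, hjn, h.trans (hR.simple_succ j hj hjn)⟩
  · exact .inr ⟨hX, h.trans (hR.simple_zero hX)⟩

lemma exists_perm_reflection_eps {s : ι} (hs : s ∈ b.support) :
    ∃ τ : Equiv.Perm ℕ, (∀ a ≤ n, τ a ≤ n) ∧
      ∀ a ≤ n, ∃ z : ℝ, z * z = 1 ∧ P.reflection s (ε a) = z • ε (τ a) := by
  have hswap : ∀ j k : ℕ, j ≤ n → k ≤ n → ∀ a ≤ n, Equiv.swap j k a ≤ n := fun j k hj hk a ha => by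
    rw [Equiv.swap_apply_def]
    split_ifs <;> assumption
  rcases hR.root_of_mem_support hs with ⟨j, hj, hjn, hroot⟩ | ⟨hX, hroot⟩
  · by_cases hlj : X.sqLength (j - 1) = 1
    · refine ⟨Equiv.swap j (j - 1), hswap _ _ hjn (by omega), fun a ha => ⟨1, mul_one 1, ?_⟩⟩
      rw [hR.reflection_eps_of_long (x := 1) (y := -1) (by rw [hroot]; module) (by omega) hjn ha
        (by omega) (by norm_num) (by norm_num) hlj (X.sqLength_of_pos hj), Equiv.swap_apply_def]
      split_ifs <;> module
    · obtain rfl : j = 1 := by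
        by_contra hj1
        exact hlj (X.sqLength_of_pos (by omega))
      have hX := X.sq_eq_zero_or_one.resolve_right hlj
      rw [Nat.sub_self, hR.eps_zero hX, sub_zero] at hroot
      refine ⟨1, fun _ ha => ha, fun a ha => ?_⟩
      rw [hR.reflection_eps_of_short hroot hjn ha (X.sqLength_of_pos one_pos), Equiv.Perm.one_apply]
      split_ifs with ha1
      · exact ⟨-1, by norm_num, by rw [ha1]; module⟩
      · exact ⟨1, mul_one 1, (one_smul ℝ _).symm⟩
  · refine ⟨Equiv.swap 1 0, hswap _ _ hR.one_le n.zero_le, fun a ha => ?_⟩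
    rw [hR.reflection_eps_of_long (x := 1) (y := 1) (by rw [hroot]; module) n.zero_le hR.one_le ha
      zero_ne_one (mul_one 1) (mul_one 1) (X.sqLength_zero.trans hX) (X.sqLength_of_pos one_pos),
      Equiv.swap_apply_def]
    split_ifs
    · exact ⟨-1, by norm_num, by module⟩
    · exact ⟨-1, by norm_num, by module⟩
    · exact ⟨1, mul_one 1, (one_smul ℝ _).symm⟩

lemma exists_root_eq_smul_add_smul [Finite ι] [P.IsCrystallographic] [P.IsReduced] (i : ι) :
    ∃ (a c : ℕ) (x y : ℝ), a ≠ c ∧ a ≤ n ∧ c ≤ n ∧ x * x = 1 ∧ y * y = 1 ∧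
      P.root i = x • ε c + y • ε a := by
  refine Base.induction_reflect (b := b) i (p := fun i => ∃ (a c : ℕ) (x y : ℝ), a ≠ c ∧ a ≤ n ∧
    c ≤ n ∧ x * x = 1 ∧ y * y = 1 ∧ P.root i = x • ε c + y • ε a) ?_ ?_ ?_
  · rintro i ⟨a, c, x, y, hac, ha, hc, hx, hy, h⟩
    refine ⟨a, c, -x, -y, hac, ha, hc, by rwa [neg_mul_neg], by rwa [neg_mul_neg], ?_⟩
    rw [root_reflectionPerm_self, h]
    module
  · intro s hs
    rcases hR.root_of_mem_support hs with ⟨j, hj, hjn, h⟩ | ⟨-, h⟩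
    · exact ⟨j - 1, j, 1, -1, by omega, by omega, hjn, by norm_num, by norm_num, by rw [h]; module⟩
    · exact ⟨0, 1, 1, 1, zero_ne_one, n.zero_le, hR.one_le, mul_one 1, mul_one 1,
        by rw [h]; module⟩
  · rintro i s ⟨a, c, x, y, hac, ha, hc, hx, hy, h⟩ hs
    obtain ⟨τ, hτ, hreflection⟩ := hR.exists_perm_reflection_eps hs
    obtain ⟨z, hz, hza⟩ := hreflection a ha
    obtain ⟨w, hw, hwc⟩ := hreflection c hc
    refine ⟨τ a, τ c, x * w, y * z, τ.injective.ne hac, hτ a ha, hτ c hc, ?_, ?_, ?_⟩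
    · rw [mul_mul_mul_comm, hx, hw, mul_one]
    · rw [mul_mul_mul_comm, hy, hz, mul_one]
    · rw [root_reflectionPerm, h, map_add, map_smul, map_smul, hza, hwc, smul_smul, smul_smul]

lemma root_of_isPos [Finite ι] [P.IsCrystallographic] [P.IsReduced] {i : ι} (hi : b.IsPos i) :
    ∃ a c, a < c ∧ c ≤ n ∧ (P.root i = ε c - ε a ∨ P.root i = ε c + ε a) := by
  obtain ⟨a, c, x, y, hac, hc, hx, hy, h⟩ : ∃ (a c : ℕ) (x y : ℝ), a < c ∧ c ≤ n ∧ x * x = 1 ∧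
      y * y = 1 ∧ P.root i = x • ε c + y • ε a := by
    obtain ⟨a, c, x, y, hac, ha, hc, hx, hy, h⟩ := hR.exists_root_eq_smul_add_smul i
    rcases hac.lt_or_gt with hlt | hlt
    · exact ⟨a, c, x, y, hlt, hc, hx, hy, h⟩
    · exact ⟨c, a, y, x, hlt, ha, hy, hx, by rw [h, add_comm]⟩
  refine ⟨a, c, hac, hc, ?_⟩
  have hheight : (0 : ℝ) < x * c + y * a := by
    have hpos : (0 : ℝ) < b.height i := by exact_mod_cast hi
    rwa [← heightFun_root, h, map_add, map_smul, map_smul, hR.height_eps c hc,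
      hR.height_eps a (by omega), smul_eq_mul, smul_eq_mul] at hpos
  have hac' : (a : ℝ) < c := by exact_mod_cast hac
  rcases mul_self_eq_one_iff.mp hx with rfl | rfl <;>
    rcases mul_self_eq_one_iff.mp hy with rfl | rfl
  · exact .inr (by rw [h]; module)
  · exact .inl (by rw [h]; module)
  · linarith [a.cast_nonneg (α := ℝ)]
  · linarith [c.cast_nonneg (α := ℝ)]

lemma exists_root_sub {a c : ℕ} (hac : a < c) (hc : c ≤ n) : ∃ i, P.root i = ε c - ε a := by
  induction c, hac using Nat.le_induction with
  | base =>
    obtain ⟨i, -, hi⟩ := exists_root_eq_simpleRoot e (Nat.succ_pos a) hc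
    exact ⟨i, hi.trans (hR.simple_succ _ (Nat.succ_pos a) hc)⟩
  | succ c hac ih =>
    obtain ⟨i, hi⟩ := ih (by omega)
    obtain ⟨s, -, hs⟩ := exists_root_eq_simpleRoot (j := c + 1) e (Nat.succ_pos c) hc
    rw [hR.simple_succ (c + 1) (Nat.succ_pos c) hc, Nat.add_sub_cancel] at hs
    have hreflection : ∀ d ≤ n, P.reflection s (ε d) =
        if d = c + 1 then -((1 : ℝ) * -1) • ε c else if d = c then -((1 : ℝ) * -1) • ε (c + 1)
        else ε d := fun d hd =>
      hR.reflection_eps_of_long (by rw [hs]; module) (by omega) hc hd (by omega) (by norm_num)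
        (by norm_num) (X.sqLength_of_pos (by omega)) (X.sqLength_of_pos (by omega))
    refine ⟨P.reflectionPerm s i, ?_⟩
    rw [root_reflectionPerm, hi, map_sub, hreflection c (by omega), hreflection a (by omega),
      if_neg (by omega), if_pos rfl, if_neg (by omega), if_neg (by omega)]
    module

lemma exists_root_add_zero (hX : X.sq = 1) {c : ℕ} (hc0 : 1 ≤ c) (hc : c ≤ n) :
    ∃ i, P.root i = ε c + ε 0 := by
  obtain ⟨i, -, hi⟩ := exists_root_eq_simpleRoot_zero e hX
  rw [hR.simple_zero hX] at hi
  obtain rfl | hc1 := hc0.eq_or_lt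
  · exact ⟨i, hi⟩
  obtain ⟨s, hs⟩ := hR.exists_root_sub hc1 hc
  have hreflection : ∀ d ≤ n, P.reflection s (ε d) =
      if d = c then -((1 : ℝ) * -1) • ε 1 else if d = 1 then -((1 : ℝ) * -1) • ε c else ε d :=
    fun d hd => hR.reflection_eps_of_long (by rw [hs]; module) hR.one_le hc hd hc1.ne
      (by norm_num) (by norm_num) (X.sqLength_of_pos one_pos) (X.sqLength_of_pos hc0)
  refine ⟨P.reflectionPerm s i, ?_⟩
  rw [root_reflectionPerm, hi, map_add, hreflection 1 hR.one_le, hreflection 0 n.zero_le,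
    if_neg hc1.ne, if_pos rfl, if_neg (by omega), if_neg zero_ne_one]
  module

lemma exists_root_add {a c : ℕ} (hac : a < c) (hc : c ≤ n) : ∃ i, P.root i = ε c + ε a := by
  rcases Nat.eq_zero_or_pos a with rfl | ha <;> rcases X.sq_eq_zero_or_one with hX | hX
  · obtain ⟨i, hi⟩ := hR.exists_root_sub hac hc
    exact ⟨i, by rw [hi, hR.eps_zero hX, sub_zero, add_zero]⟩
  · exact hR.exists_root_add_zero hX hac hc
  · obtain ⟨i, hi⟩ := hR.exists_root_sub hac hc
    obtain ⟨s, hs⟩ := hR.exists_root_sub ha (hac.le.trans hc)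
    rw [hR.eps_zero hX, sub_zero] at hs
    have hreflection : ∀ d ≤ n, P.reflection s (ε d) = if d = a then -ε a else ε d := fun d hd =>
      hR.reflection_eps_of_short hs (hac.le.trans hc) hd (X.sqLength_of_pos ha)
    refine ⟨P.reflectionPerm s i, ?_⟩
    rw [root_reflectionPerm, hi, map_sub, hreflection c hc, hreflection a (hac.le.trans hc),
      if_neg hac.ne', if_pos rfl, sub_neg_eq_add]
  · obtain ⟨i, hi⟩ := hR.exists_root_add_zero hX (by omega) hc
    obtain ⟨s, hs⟩ := hR.exists_root_sub ha (hac.le.trans hc)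
    have hreflection : ∀ d ≤ n, P.reflection s (ε d) =
        if d = a then -((1 : ℝ) * -1) • ε 0 else if d = 0 then -((1 : ℝ) * -1) • ε a else ε d :=
      fun d hd => hR.reflection_eps_of_long (by rw [hs]; module) n.zero_le (hac.le.trans hc) hd
        ha.ne (by norm_num) (by norm_num) (X.sqLength_zero.trans hX) (X.sqLength_of_pos ha)
    refine ⟨P.reflectionPerm s i, ?_⟩
    rw [root_reflectionPerm, hi, map_add, hreflection c hc, hreflection 0 n.zero_le,
      if_neg hac.ne', if_neg (by omega), if_neg ha.ne, if_pos rfl]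
    module

end Realization

end Realization

/-! ### The simple roots of `R(m)` -/

section Signed

variable {V : Type*} [AddCommGroup V]

/-- The vector `ε_a` for an integer `a`, with the convention `ε_{-a} = -ε_a` for `a > 0`. -/
def signed (ε : ℕ → V) (a : ℤ) : V := if 0 ≤ a then ε a.natAbs else -ε a.natAbs

lemma signed_natCast (ε : ℕ → V) (a : ℕ) : signed ε a = ε a := if_pos a.cast_nonneg

lemma signed_of_neg (ε : ℕ → V) {a : ℤ} (ha : a < 0) : signed ε a = -ε a.natAbs :=
  if_neg ha.not_ge

lemma signed_neg_natCast (ε : ℕ → V) {a : ℕ} (ha : 0 < a) : signed ε (-a) = -ε a := by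
  rw [signed_of_neg ε (by omega), Int.natAbs_neg, Int.natAbs_natCast]

lemma exists_signed_eq_smul [Module ℝ V] (ε : ℕ → V) (a : ℤ) :
    ∃ x : ℝ, x * x = 1 ∧ x * a.natAbs = a ∧ signed ε a = x • ε a.natAbs := by
  rcases le_or_gt 0 a with h | h
  · exact ⟨1, one_mul 1, by rw [one_mul, Nat.cast_natAbs, abs_of_nonneg h],
      by rw [signed, if_pos h, one_smul]⟩
  · exact ⟨-1, by norm_num,
      by rw [Nat.cast_natAbs, abs_of_neg h, Int.cast_neg, neg_one_mul, neg_neg],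
      by rw [signed_of_neg ε h, neg_one_smul]⟩

end Signed

section SimpleRoots

variable {ι V N : Type*} [AddCommGroup V] [Module ℝ V] [AddCommGroup N] [Module ℝ N]
  {P : RootPairing ι ℝ V N} {b : P.Base}

lemma mem_posRootsMult_of_height_eq {m : ℕ} {i : ι} {h : ℤ} (hi : b.height i = h)
    (hdvd : (m : ℤ) ∣ h) (hpos : 0 < h) : i ∈ posRootsMult b m :=
  ⟨by rwa [rootsMult, Set.mem_ofPred_eq, hi], by rwa [Base.isPos_iff, hi]⟩

lemma mem_simpleRootsMult_of_height {m : ℕ} (hm : 1 ≤ m) {i : ι} (hi : b.height i = m) :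
    i ∈ simpleRootsMult b m := by
  refine ⟨mem_posRootsMult_of_height_eq hi dvd_rfl (by omega), ?_⟩
  rintro ⟨j, hj, l, hl, hadd⟩
  have hheight := b.height_add hadd
  have hmj := Int.le_of_dvd hj.2 hj.1
  have hml := Int.le_of_dvd hl.2 hl.1
  omega

variable [P.IsRootSystem] {X : Family} {n : ℕ} {e : Fin (X.rank n) ≃ b.support}
  {ε : ℕ → V} {g : V →ₗ[ℝ] V →ₗ[ℝ] ℝ}

namespace Realization

variable (hR : Realization X n e ε g)

include hR

lemma height_signed {a : ℤ} (ha : a.natAbs ≤ n) : heightFun b (signed ε a) = a := by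
  obtain ⟨x, -, hx, h⟩ := exists_signed_eq_smul ε a
  rw [h, map_smul, hR.height_eps _ ha, smul_eq_mul, hx]

lemma form_signed_of_ne {a c : ℤ} (ha : a.natAbs ≤ n) (hc : c.natAbs ≤ n)
    (hac : a.natAbs ≠ c.natAbs) : g (signed ε a) (signed ε c) = 0 := by
  obtain ⟨x, -, -, h⟩ := exists_signed_eq_smul ε a
  obtain ⟨y, -, -, h'⟩ := exists_signed_eq_smul ε c
  rw [h, h', map_smul, map_smul, LinearMap.smul_apply, hR.form_eps _ _ ha hc, if_neg hac,
    smul_zero, smul_zero]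

lemma form_signed_self {a : ℤ} (ha : a.natAbs ≤ n) (ha0 : a ≠ 0) :
    g (signed ε a) (signed ε a) = 1 := by
  obtain ⟨x, hx, -, h⟩ := exists_signed_eq_smul ε a
  rw [h, map_smul, map_smul, LinearMap.smul_apply, hR.form_eps _ _ ha ha, if_pos rfl,
    X.sqLength_of_pos (Int.natAbs_pos.mpr ha0), smul_eq_mul, smul_eq_mul, mul_one, hx]

lemma exists_root_smul_add_smul {a c : ℕ} (ha : a ≤ n) (hc : c ≤ n) (hac : a ≠ c) {x y : ℝ}
    (hx : x * x = 1) (hy : y * y = 1) : ∃ i, P.root i = x • ε a + y • ε c := by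
  wlog hlt : a < c generalizing a c x y
  · obtain ⟨i, hi⟩ := this hc ha hac.symm hy hx (by omega)
    exact ⟨i, by rw [hi, add_comm]⟩
  obtain ⟨i, hi⟩ := hR.exists_root_sub hlt hc
  obtain ⟨j, hj⟩ := hR.exists_root_add hlt hc
  rcases mul_self_eq_one_iff.mp hx with rfl | rfl <;>
    rcases mul_self_eq_one_iff.mp hy with rfl | rfl
  · exact ⟨j, by rw [hj]; module⟩
  · exact ⟨P.reflectionPerm i i, by rw [root_reflectionPerm_self, hi]; module⟩
  · exact ⟨i, by rw [hi]; module⟩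
  · exact ⟨P.reflectionPerm j j, by rw [root_reflectionPerm_self, hj]; module⟩

lemma exists_root_signed_sub {a c : ℤ} (ha : a.natAbs ≤ n) (hc : c.natAbs ≤ n)
    (hac : a.natAbs ≠ c.natAbs) : ∃ i, P.root i = signed ε a - signed ε c := by
  obtain ⟨x, hx, -, h⟩ := exists_signed_eq_smul ε a
  obtain ⟨y, hy, -, h'⟩ := exists_signed_eq_smul ε c
  obtain ⟨i, hi⟩ := hR.exists_root_smul_add_smul ha hc hac hx (y := -y) (by rwa [neg_mul_neg])
  exact ⟨i, by rw [hi, h, h', neg_smul, sub_eq_add_neg]⟩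

lemma height_of_root_eq_sub {i : ι} {a c : ℤ} (ha : a.natAbs ≤ n) (hc : c.natAbs ≤ n)
    (h : P.root i = signed ε a - signed ε c) : b.height i = a - c := by
  have hheight := heightFun_root b i
  rw [h, map_sub, hR.height_signed ha, hR.height_signed hc] at hheight
  exact_mod_cast hheight.symm

lemma height_of_root_eq_add {i : ι} {a c : ℕ} (ha : a ≤ n) (hc : c ≤ n)
    (h : P.root i = ε a + ε c) : b.height i = a + c := by
  have hheight := heightFun_root b i
  rw [h, map_add, hR.height_eps _ ha, hR.height_eps _ hc] at hheight
  exact_mod_cast hheight.symm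

lemma notMem_simpleRootsMult {m : ℕ} {i : ι} {a c x : ℤ} (ha : a.natAbs ≤ n)
    (hc : c.natAbs ≤ n) (hx : x.natAbs ≤ n) (hax : a.natAbs ≠ x.natAbs)
    (hxc : x.natAbs ≠ c.natAbs) (hdvd_ax : (m : ℤ) ∣ a - x) (hdvd_xc : (m : ℤ) ∣ x - c)
    (hlt_xa : x < a) (hlt_cx : c < x) (hi : P.root i = signed ε a - signed ε c) :
    i ∉ simpleRootsMult b m := by
  obtain ⟨j, hj⟩ := hR.exists_root_signed_sub ha hx hax
  obtain ⟨l, hl⟩ := hR.exists_root_signed_sub hx hc hxc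
  refine fun hmem => hmem.2 ⟨j, ?_, l, ?_, by rw [hi, hj, hl, sub_add_sub_cancel]⟩
  · exact mem_posRootsMult_of_height_eq (hR.height_of_root_eq_sub ha hx hj) hdvd_ax (by omega)
  · exact mem_posRootsMult_of_height_eq (hR.height_of_root_eq_sub hx hc hl) hdvd_xc (by omega)

lemma eq_of_signed_sub_mem_simpleRootsMult {m : ℕ} {i : ι} (hi : i ∈ simpleRootsMult b m) {c : ℕ}
    {a : ℤ} (hc : c ≤ n) (hac : a.natAbs < c) (hroot : P.root i = ε c - signed ε a)
    (hheight : 2 * (m : ℤ) ≤ b.height i) : (m : ℤ) = -2 * a ∧ (c : ℤ) = -3 * a := by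
  have hm : 0 < m := by
    refine Nat.pos_of_ne_zero fun hm => hi.1.2.ne' ?_
    simpa [rootsMult, hm] using hi.1.1
  rw [← signed_natCast ε c] at hroot
  have hc' : (c : ℤ).natAbs ≤ n := hc
  have heq := hR.height_of_root_eq_sub hc' (by omega) hroot
  have hdvd : (m : ℤ) ∣ c - a - m := dvd_sub (heq ▸ hi.1.1) dvd_rfl
  -- The root can be split neither at `c - m` nor at `a + m`, so both of these are `-a`.
  have hcm : (c - m : ℤ).natAbs = a.natAbs := by
    by_contra hne
    exact hR.notMem_simpleRootsMult (x := c - m) hc' (by omega) (by omega) (by omega) hne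
      (by simp) (by rwa [sub_right_comm]) (by omega) (by omega) hroot hi
  have ham : (a + m : ℤ).natAbs = a.natAbs := by
    by_contra hne
    exact hR.notMem_simpleRootsMult (x := a + m) hc' (by omega) (by omega) (by omega) hne
      (by rwa [← sub_sub]) (by simp) (by omega) (by omega) hroot hi
  omega

lemma add_eps_zero_notMem_simpleRootsMult {m : ℕ} (hm : 1 ≤ m) {i : ι} {c : ℕ} (hc : c ≤ n)
    (hroot : P.root i = ε c + ε 0) (hheight : 2 * (m : ℤ) ≤ b.height i) :
    i ∉ simpleRootsMult b m := by
  intro hi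
  have heq := hR.height_of_root_eq_add hc n.zero_le hroot
  obtain ⟨j, hj⟩ := hR.exists_root_sub (a := c - m) (c := c) (by omega) hc
  obtain ⟨l, hl⟩ := hR.exists_root_add (a := 0) (c := c - m) (by omega) (by omega)
  have hl_height := hR.height_of_root_eq_add (Nat.sub_le_of_le_add (by omega)) n.zero_le hl
  have hadd : P.root i = P.root j + P.root l := by rw [hroot, hj, hl]; abel
  have hj_height : b.height j = m := by
    have := b.height_add hadd
    omega
  refine hi.2 ⟨j, mem_posRootsMult_of_height_eq hj_height dvd_rfl (by omega), l, ?_, hadd⟩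
  refine mem_posRootsMult_of_height_eq hl_height ?_ (by omega)
  rw [← hl_height, ← add_sub_cancel_left (b.height j) (b.height l), ← b.height_add hadd, hj_height]
  exact dvd_sub hi.1.1 dvd_rfl

lemma height_or_root_of_mem_simpleRootsMult [Finite ι] [P.IsCrystallographic] [P.IsReduced] {m : ℕ}
    (hm : 1 ≤ m) {i : ι} (hi : i ∈ simpleRootsMult b m) :
    b.height i = m ∨ ∃ k, m = 2 * k ∧ 3 * k ≤ n ∧ P.root i = ε (3 * k) + ε k := by
  refine or_iff_not_imp_left.mpr fun hne => ?_
  have hheight : 2 * (m : ℤ) ≤ b.height i := by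
    have hle := Int.le_of_dvd hi.1.2 hi.1.1
    have hle' := Int.le_of_dvd (by omega) (dvd_sub hi.1.1 (dvd_refl (m : ℤ)))
    omega
  obtain ⟨a, c, hac, hc, hroot | hroot⟩ := hR.root_of_isPos hi.1.2
  · have := hR.eq_of_signed_sub_mem_simpleRootsMult hi (a := a) hc hac
      (by rw [hroot, signed_natCast]) hheight
    omega
  · rcases Nat.eq_zero_or_pos a with rfl | ha
    · exact absurd hi (hR.add_eps_zero_notMem_simpleRootsMult hm hc hroot hheight)
    · have := hR.eq_of_signed_sub_mem_simpleRootsMult hi (a := -a) hc (by omega)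
        (by rw [hroot, signed_neg_natCast ε ha, sub_neg_eq_add]) hheight
      obtain rfl : c = 3 * a := by omega
      exact ⟨a, by omega, hc, hroot⟩

lemma form_add_add {p q a c : ℕ} (hp : p ≤ n) (hq : q ≤ n) (ha : a ≤ n) (hc : c ≤ n) (y : ℝ) :
    g (ε p + ε q) (ε c + y • ε a) =
      (if p = c then X.sqLength p else 0) + (if q = c then X.sqLength q else 0) +
        y * ((if p = a then X.sqLength p else 0) + (if q = a then X.sqLength q else 0)) := by
  simp only [map_add, map_smul, LinearMap.add_apply, smul_eq_mul, hR.form_eps _ _ hp hc,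
    hR.form_eps _ _ hq hc, hR.form_eps _ _ hp ha, hR.form_eps _ _ hq ha]

lemma form_delta_nonpos [Finite ι] [P.IsCrystallographic] [P.IsReduced] {k : ℕ} (hk : 1 ≤ k)
    (hkn : 3 * k ≤ n) {i : ι} (hi : b.height i = (2 * k : ℕ)) :
    g (ε (3 * k) + ε k) (P.root i) ≤ 0 := by
  have hlong : X.sqLength (3 * k) = 1 := X.sqLength_of_pos (by omega)
  have hlong' : X.sqLength k = 1 := X.sqLength_of_pos hk
  obtain ⟨a, c, hac, hc, h | h⟩ := hR.root_of_isPos (i := i) (by rw [Base.isPos_iff, hi]; omega)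
  · have hheight := hR.height_of_root_eq_sub (a := c) (c := a) (by omega) (by omega)
      (by simpa only [signed_natCast] using h)
    rw [h, sub_eq_add_neg, ← neg_one_smul ℝ, hR.form_add_add hkn (by omega) (by omega) hc, hlong,
      hlong']
    split_ifs <;> first | omega | norm_num
  · have hheight := hR.height_of_root_eq_add hc (by omega) h
    rw [h, ← one_smul ℝ (ε a), hR.form_add_add hkn (by omega) (by omega) hc, hlong, hlong']
    split_ifs <;> first | omega | norm_num

lemma delta_mem_simpleRootsMult [Finite ι] [P.IsCrystallographic] [P.IsReduced] {k : ℕ}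
    (hk : 1 ≤ k) (hkn : 3 * k ≤ n) {i : ι} (hi : P.root i = ε (3 * k) + ε k) :
    i ∈ simpleRootsMult b (2 * k) := by
  have hheight := hR.height_of_root_eq_add hkn (by omega) hi
  refine ⟨mem_posRootsMult_of_height_eq hheight ⟨2, by push_cast; ring⟩ (by omega), ?_⟩
  rintro ⟨j, hj, l, hl, hadd⟩
  have hheight_add := b.height_add hadd
  have hmj := Int.le_of_dvd hj.2 hj.1
  have hml := Int.le_of_dvd hl.2 hl.1
  have hj_nonpos := hR.form_delta_nonpos hk hkn (i := j) (by omega)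
  have hl_nonpos := hR.form_delta_nonpos hk hkn (i := l) (by omega)
  have hself : g (ε (3 * k) + ε k) (P.root i) = 2 := by
    rw [hi]
    nth_rw 2 [← one_smul ℝ (ε k)]
    rw [hR.form_add_add hkn (by omega) (by omega) hkn, X.sqLength_of_pos hk,
      X.sqLength_of_pos (by omega), if_pos rfl, if_neg (by omega), if_neg (by omega), if_pos rfl]
    norm_num
  rw [hadd, map_add] at hself
  linarith

end Realization

end SimpleRoots

/-! ### Residue classes of coordinates -/

section ResidueChain

variable {V : Type*} [AddCommGroup V] {n m r l p : ℕ}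

/-- The elements of `[-n, n]` congruent to `r` modulo `m`, where `0 < r < m / 2`, are the integers
`r + d * m` with `-l ≤ d ≤ p`. -/
structure ResidueChain (n m r l p : ℕ) : Prop where
  pos : 0 < r
  two_mul_lt : 2 * r < m
  lower : l * m ≤ n + r
  lower_max : n + r < (l + 1) * m
  upper : r + p * m ≤ n
  upper_max : n < r + (p + 1) * m

/-- The unit vectors `ε_a` with `a` congruent to `r` modulo `m`. -/
def residueVec (ε : ℕ → V) (m r l : ℕ) (j : ℕ) : V := signed ε ((r : ℤ) + ((j : ℤ) - l) * m)

lemma ResidueChain.natAbs_le (h : ResidueChain n m r l p) {j : ℕ} (hj : j ≤ l + p) :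
    ((r : ℤ) + ((j : ℤ) - l) * m).natAbs ≤ n := by
  have hlower : (l : ℤ) * m ≤ n + r := mod_cast h.lower
  have hupper : (r : ℤ) + p * m ≤ n := mod_cast h.upper
  have hjm : (j : ℤ) * m ≤ (l + p) * m := mul_le_mul_of_nonneg_right (mod_cast hj) m.cast_nonneg
  have hjm_nonneg : (0 : ℤ) ≤ j * m := by positivity
  rw [add_mul] at hjm
  rw [sub_mul]
  omega

lemma ResidueChain.natAbs_ne (h : ResidueChain n m r l p) {i j : ℤ} (hij : i ≠ j) :
    ((r : ℤ) + i * m).natAbs ≠ ((r : ℤ) + j * m).natAbs := by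
  have hr := h.pos
  have hrm := h.two_mul_lt
  rw [Ne, Int.natAbs_eq_natAbs_iff]
  rintro (heq | heq)
  · exact hij (mul_right_cancel₀ (by omega : (m : ℤ) ≠ 0) (add_left_cancel heq))
  · have hdvd : (m : ℤ) ∣ 2 * r := ⟨-(i + j), by linarith⟩
    have := Int.le_of_dvd (by omega) hdvd
    omega

lemma ResidueChain.exists_stepVec_eq {ε : ℕ → V} (h : ResidueChain n m r l p) {a : ℤ}
    (hdvd : (m : ℤ) ∣ a - r) (hna : -(n : ℤ) ≤ a) (han : a + m ≤ n) :
    ∃ x, stepVec (residueVec ε m r l) (l + p) x = signed ε (a + m) - signed ε a := by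
  obtain ⟨d, hd⟩ := hdvd
  have hm : (0 : ℤ) < m := by have := h.two_mul_lt; omega
  have hlower : (n : ℤ) + r < (l + 1) * m := mod_cast h.lower_max
  have hupper : (n : ℤ) < r + (p + 1) * m := mod_cast h.upper_max
  have hld : -(l : ℤ) < d + 1 := lt_of_mul_lt_mul_left (by linarith) hm.le
  have hdp : d < p := lt_of_mul_lt_mul_left (by linarith) hm.le
  refine ⟨⟨(d + l).toNat, by omega⟩, ?_⟩
  simp only [stepVec, residueVec]
  push_cast
  rw [Int.toNat_of_nonneg (by omega)]
  congr 2 <;> linear_combination -hd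

end ResidueChain

section ClassSpan

variable {V : Type*} [AddCommGroup V] [Module ℝ V] {n m r l p q : ℕ}

/-- The span of the `ε_a` with `a` congruent to `±r` modulo `m`. -/
def classSpan (ε : ℕ → V) (n m r : ℕ) : Submodule ℝ V :=
  Submodule.span ℝ (ε '' {a | a ≤ n ∧ ((m : ℤ) ∣ a - r ∨ (m : ℤ) ∣ a + r)})

lemma eps_mem_classSpan (ε : ℕ → V) {a : ℕ} (ha : a ≤ n) (h : (m : ℤ) ∣ a - r) :
    ε a ∈ classSpan ε n m r :=
  Submodule.subset_span ⟨a, ⟨ha, .inl h⟩, rfl⟩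

lemma signed_mem_classSpan (ε : ℕ → V) {a : ℤ} (ha : a.natAbs ≤ n) (h : (m : ℤ) ∣ a - r) :
    signed ε a ∈ classSpan ε n m r := by
  obtain ⟨x, -, -, hx⟩ := exists_signed_eq_smul ε a
  rw [hx]
  refine Submodule.smul_mem _ _ (Submodule.subset_span ⟨_, ⟨ha, ?_⟩, rfl⟩)
  rcases Int.natAbs_eq a with heq | heq
  · exact .inl (heq ▸ h)
  · refine .inr ?_
    rwa [← dvd_neg, neg_add', ← heq]

lemma stepVec_residueVec_mem_classSpan (ε : ℕ → V) (h : ResidueChain n m r l p)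
    (x : Fin (l + p)) : stepVec (residueVec ε m r l) (l + p) x ∈ classSpan ε n m r :=
  sub_mem (signed_mem_classSpan ε (h.natAbs_le x.2) (by simp))
    (signed_mem_classSpan ε (h.natAbs_le x.2.le) (by simp))

lemma chainVec_mem (X : Family) {u : ℕ → V} {W : Submodule ℝ V} (hq : 1 ≤ q)
    (hu : ∀ c ≤ q, u c ∈ W) (x : Fin (X.rank q)) : chainVec X u q x ∈ W := by
  unfold chainVec
  split_ifs
  · exact add_mem (hu _ hq) (hu _ q.zero_le)
  · exact sub_mem (hu _ (by omega)) (hu _ (by omega))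

lemma chainVec_mul_mem_classSpan (X : Family) (ε : ℕ → V) (hq : 1 ≤ q) (hn : q * m ≤ n)
    (x : Fin (X.rank q)) : chainVec X (fun c => ε (c * m)) q x ∈ classSpan ε n m 0 :=
  chainVec_mem X hq (fun c hc => eps_mem_classSpan ε (hn.trans' (by gcongr)) (by simp)) x

lemma chainVec_add_mul_mem_classSpan (X : Family) (ε : ℕ → V) (hq : 1 ≤ q) (hn : r + q * m ≤ n)
    (x : Fin (X.rank q)) : chainVec X (fun c => ε (r + c * m)) q x ∈ classSpan ε n m r :=
  chainVec_mem X hq (fun c hc => eps_mem_classSpan ε (hn.trans' (by gcongr)) (by simp)) x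

lemma eq_of_dvd_sub_or_add {a : ℤ} {r' : ℕ} (hr : 2 * r ≤ m) (hr' : 2 * r' ≤ m)
    (h : (m : ℤ) ∣ a - r ∨ (m : ℤ) ∣ a + r) (h' : (m : ℤ) ∣ a - r' ∨ (m : ℤ) ∣ a + r') :
    r = r' := by
  have hdvd : (m : ℤ) ∣ r - r' ∨ (m : ℤ) ∣ r + r' := by
    rcases h with h | h <;> rcases h' with h' | h'
    · exact .inl (by simpa using dvd_sub h' h)
    · exact .inr (by simpa [add_comm] using dvd_sub h' h)
    · exact .inr (by simpa using dvd_sub h h')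
    · exact .inl (by simpa using dvd_sub h h')
  rcases hdvd with hdvd | hdvd
  · rcases Nat.eq_zero_or_pos m with rfl | hm
    · omega
    · have := Int.eq_zero_of_abs_lt_dvd hdvd (by rw [abs_lt]; omega)
      omega
  · rcases Nat.eq_zero_or_pos (r + r') with hzero | hpos
    · omega
    · have := Int.le_of_dvd (by omega) hdvd
      omega

end ClassSpan

section Diagrams

variable {ι V N : Type*} [AddCommGroup V] [Module ℝ V] [AddCommGroup N] [Module ℝ N]
  {P : RootPairing ι ℝ V N} {b : P.Base} [P.IsRootSystem] {X : Family} {n : ℕ}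
  {e : Fin (X.rank n) ≃ b.support} {ε : ℕ → V} {g : V →ₗ[ℝ] V →ₗ[ℝ] ℝ}

namespace Realization

variable (hR : Realization X n e ε g)

include hR

lemma form_root_pos [Finite ι] [P.IsCrystallographic] [P.IsReduced] (i : ι) :
    0 < g (P.root i) (P.root i) := by
  obtain ⟨a, c, x, y, hac, ha, hc, hx, hy, h⟩ := hR.exists_root_eq_smul_add_smul i
  rw [h, hR.form_self_smul_add_smul ha hc hac, hx, hy, one_mul, one_mul]
  have hsq : 0 ≤ X.sq := by rcases X.sq_eq_zero_or_one with h | h <;> rw [h]; exact zero_le_one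
  simp only [Family.sqLength]
  split_ifs <;> first | omega | linarith

lemma hasDiagram_of_represents [Finite ι] [P.IsCrystallographic] [P.IsReduced] {κ : Type}
    {v : κ → V} {A : Matrix κ κ ℤ} {S : Set ι} (hv : Represents g v A) (hA : OffDiagNonpos A)
    (hS : P.root '' S = Set.range v) : HasDiagram P S A := by
  have hroot (x : κ) : ∃ i ∈ S, P.root i = v x :=
    (Set.mem_image _ _ _).mp (hS ▸ Set.mem_range_self x)
  choose f hfS hf using hroot
  have hpos (x : κ) : 0 < g (v x) (v x) := hf x ▸ hR.form_root_pos (f x)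
  have hinj : Function.Injective v := by
    intro x y hxy
    by_contra hne
    have heq := hv x y
    rw [hxy] at heq
    have htwo : 2 = A x y := by exact_mod_cast mul_right_cancel₀ (hpos y).ne' heq
    have := hA x y hne
    omega
  refine ⟨Equiv.ofBijective (fun x => ⟨f x, hfS x⟩) ⟨fun x y hxy => ?_, fun i => ?_⟩,
    fun x y => ?_⟩
  · exact hinj (by rw [← hf, ← hf, show f x = f y from congrArg Subtype.val hxy])
  · obtain ⟨x, hx⟩ : P.root i ∈ Set.range v := hS ▸ Set.mem_image_of_mem _ i.2
    exact ⟨x, Subtype.ext (P.root.injective (by rw [hf, hx]))⟩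
  · have heq := hR.pairing_mul (f x) (f y)
    rw [hf, hf, hv x y, pairing_eq_cast_pairingIn] at heq
    exact_mod_cast mul_right_cancel₀ (hpos y).ne' heq

lemma form_eq_zero_of_mem_classSpan {m r r' : ℕ} (hr : 2 * r ≤ m) (hr' : 2 * r' ≤ m)
    (hne : r ≠ r') {v w : V} (hv : v ∈ classSpan ε n m r) (hw : w ∈ classSpan ε n m r') :
    g v w = 0 := by
  induction hv, hw using Submodule.span_induction₂ with
  | mem_mem v w hv hw =>
    obtain ⟨a, ⟨ha, har⟩, rfl⟩ := hv
    obtain ⟨c, ⟨hc, hcr⟩, rfl⟩ := hw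
    rw [hR.form_eps _ _ ha hc, if_neg]
    rintro rfl
    exact hne (eq_of_dvd_sub_or_add hr hr' har hcr)
  | zero_left w _ => rw [map_zero, LinearMap.zero_apply]
  | zero_right v _ => rw [map_zero]
  | add_left v₁ v₂ w _ _ _ h₁ h₂ => rw [map_add, LinearMap.add_apply, h₁, h₂, add_zero]
  | add_right v w₁ w₂ _ _ _ h₁ h₂ => rw [map_add, h₁, h₂, add_zero]
  | smul_left x v w _ _ h => rw [map_smul, LinearMap.smul_apply, h, smul_zero]
  | smul_right x v w _ _ h => rw [map_smul, h, smul_zero]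

lemma represents_stepVec_residueVec {m r l p : ℕ} (h : ResidueChain n m r l p) :
    Represents g (stepVec (residueVec ε m r l) (l + p)) (typeA (l + p)) := by
  refine OrthogonalUpTo.represents_stepVec fun i j hi hj => ?_
  have hi_le := h.natAbs_le hi
  have hj_le := h.natAbs_le hj
  split_ifs with hij
  · subst hij
    refine hR.form_signed_self hi_le fun hzero => ?_
    have hdvd : (m : ℤ) ∣ r := ⟨-(i - l), by linarith⟩
    have := Int.le_of_dvd (by have := h.pos; omega) hdvd
    have := h.two_mul_lt
    omega
  · exact hR.form_signed_of_ne hi_le hj_le (h.natAbs_ne (by omega))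

lemma exists_root_stepVec_residueVec {m r l p : ℕ} (h : ResidueChain n m r l p)
    (x : Fin (l + p)) :
    ∃ i, b.height i = m ∧ P.root i = stepVec (residueVec ε m r l) (l + p) x := by
  have hx := h.natAbs_le (j := x) (by omega)
  have hx' := h.natAbs_le (j := x + 1) (by omega)
  obtain ⟨i, hi⟩ := hR.exists_root_signed_sub hx' hx (h.natAbs_ne (by push_cast; omega))
  refine ⟨i, ?_, hi⟩
  rw [hR.height_of_root_eq_sub hx' hx hi]
  push_cast
  ring

lemma represents_chainVec_mul {m q : ℕ} (hm : 1 ≤ m) (hq : 1 ≤ q) (hn : q * m ≤ n) :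
    Represents g (chainVec X (fun c => ε (c * m)) q) (X.BD q) := by
  refine OrthogonalUpTo.represents_chainVec hq fun a c ha hc => ?_
  rw [hR.form_eps _ _ (hn.trans' (by gcongr)) (hn.trans' (by gcongr))]
  simp [Family.sqLength, Nat.one_le_iff_ne_zero.mp hm]

lemma exists_root_eps_add_sub {m a : ℕ} (hm : 1 ≤ m) (ha : a + m ≤ n) :
    ∃ i, b.height i = m ∧ P.root i = ε (a + m) - ε a := by
  obtain ⟨i, hi⟩ := hR.exists_root_sub (a := a) (c := a + m) (by omega) ha
  refine ⟨i, ?_, hi⟩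
  rw [hR.height_of_root_eq_sub (a := (a + m : ℕ)) (c := a) (by omega) (by omega)
    (by simpa only [signed_natCast] using hi)]
  push_cast
  ring

lemma exists_root_chainVec_mul {m q : ℕ} (hm : 1 ≤ m) (hq : 1 ≤ q) (hn : q * m ≤ n)
    (x : Fin (X.rank q)) :
    ∃ i, b.height i = m ∧ P.root i = chainVec X (fun c => ε (c * m)) q x := by
  unfold chainVec
  split_ifs with hxq
  · have hmn : m ≤ n := hn.trans' (Nat.le_mul_of_pos_left m hq)
    obtain ⟨i, hi⟩ := hR.exists_root_add hm hmn
    exact ⟨i, by simpa using hR.height_of_root_eq_add hmn n.zero_le hi, by simpa using hi⟩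
  · have hrank := X.rank_le q
    obtain ⟨d, hd⟩ : ∃ d, q - (x : ℕ) = d + 1 := ⟨q - x - 1, by omega⟩
    simp only [hd, Nat.add_sub_cancel, add_one_mul]
    exact hR.exists_root_eps_add_sub hm
      (hn.trans' ((add_one_mul d m).symm.le.trans (by gcongr; omega)))

lemma exists_chainVec_mul_eq {m q t : ℕ} (hnq : n = q * m + t) (ht : t < m) {i : ι} {a : ℕ}
    (ha : m ∣ a) (han : a + m ≤ n)
    (hi : P.root i = ε (a + m) - ε a ∨ (a = 0 ∧ P.root i = ε (a + m) + ε a)) :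
    ∃ x, P.root i = chainVec X (fun c => ε (c * m)) q x := by
  wlog hsub : P.root i = ε (a + m) - ε a
  · obtain ⟨rfl, hadd⟩ := hi.resolve_left hsub
    rcases X.sq_eq_zero_or_one with hX | hX
    · rw [hR.eps_zero hX, sub_zero] at hsub
      rw [hR.eps_zero hX, add_zero] at hadd
      exact absurd hadd hsub
    · exact ⟨⟨q, Family.lt_rank_of_sq_eq_one hX q⟩, by simpa [chainVec] using hadd⟩
  obtain ⟨d, rfl⟩ := ha
  have hd : d < q := by
    refine Nat.lt_of_add_lt_add_right (n := 1) (lt_of_mul_lt_mul_left (a := m) ?_ m.zero_le)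
    linarith
  refine ⟨⟨q - 1 - d, by have := X.le_rank q; omega⟩, ?_⟩
  have hpred : q - (q - 1 - d) = d + 1 := by omega
  simp only [chainVec]
  rw [if_neg (by omega), hpred, Nat.add_sub_cancel, add_one_mul, mul_comm d m, hsub]

end Realization

end Diagrams

/-! ### The diagram of `R_m` outside the residue class `m / 2` -/

/-- A set of `c` residue classes `r, …, r + c - 1`, each with a chain of `l + p` steps. -/
structure ResidueGroup where
  /-- the first residue class -/
  r : ℕ
  /-- the number of steps below the representative -/
  l : ℕ
  /-- the number of steps above the representative -/
  p : ℕ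
  /-- the number of residue classes -/
  c : ℕ

/-- All residue classes of `G` have the chains that `G` prescribes. -/
def ResidueGroup.IsValid (G : ResidueGroup) (n m : ℕ) : Prop :=
  ∀ s < G.c, ResidueChain n m (G.r + s) G.l G.p

/-- The residue classes of `G` and `H` are all the residue classes modulo `m`, up to sign and
except for `0` and `m / 2`. -/
structure ResidueCover (n m : ℕ) (G H : ResidueGroup) : Prop where
  left : G.IsValid n m
  right : H.IsValid n m
  disjoint : ∀ s < G.c, ∀ s' < H.c, G.r + s ≠ H.r + s'
  cover : ∀ r, 0 < r → 2 * r < m → (∃ s < G.c, r = G.r + s) ∨ ∃ s < H.c, r = H.r + s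

section Cover

variable {n m q t : ℕ}

lemma ResidueCover.symm {G H : ResidueGroup} (h : ResidueCover n m G H) :
    ResidueCover n m H G where
  left := h.right
  right := h.left
  disjoint s hs s' hs' := (h.disjoint s' hs' s hs).symm
  cover r hr hrm := (h.cover r hr hrm).symm

lemma residueChain_of_le_of_add_lt {r : ℕ} (hnq : n = q * m + t) (hr : 0 < r) (hrm : 2 * r < m)
    (hrt : r ≤ t) (htr : t + r < m) : ResidueChain n m r q q where
  pos := hr
  two_mul_lt := hrm
  lower := by omega
  lower_max := by rw [add_one_mul]; omega
  upper := by omega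
  upper_max := by rw [add_one_mul]; omega

lemma residueChain_of_lt {r : ℕ} (hnq : n = q * m + t) (hq : 1 ≤ q) (hr : 0 < r) (hrm : 2 * r < m)
    (htr : t < r) : ResidueChain n m r q (q - 1) where
  pos := hr
  two_mul_lt := hrm
  lower := by omega
  lower_max := by rw [add_one_mul]; omega
  upper := by
    have := Nat.le_mul_of_pos_left m hq
    rw [tsub_one_mul]
    omega
  upper_max := by rw [Nat.sub_add_cancel hq]; omega

lemma residueChain_of_le_add {r : ℕ} (hnq : n = q * m + t) (ht : t < m) (hr : 0 < r)
    (hrm : 2 * r < m) (htr : m ≤ t + r) : ResidueChain n m r (q + 1) q where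
  pos := hr
  two_mul_lt := hrm
  lower := by rw [add_one_mul]; omega
  lower_max := by rw [add_one_mul, add_one_mul]; omega
  upper := by omega
  upper_max := by rw [add_one_mul]; omega

lemma residueCover_low {d : ℕ} (hnq : n = q * m + t) (hq : 1 ≤ q) (ht : 2 * t < m)
    (hd : ∀ r, 2 * r < m ↔ r ≤ d) :
    ResidueCover n m ⟨1, q, q, t⟩ ⟨t + 1, q, q - 1, d - t⟩ where
  left s hs := by
    dsimp only at *
    exact residueChain_of_le_of_add_lt hnq (by omega) (by omega) (by omega) (by omega)
  right s hs := by
    dsimp only at *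
    exact residueChain_of_lt hnq hq (by omega) ((hd _).2 (by omega)) (by omega)
  disjoint s hs s' _ := by
    dsimp only at *
    omega
  cover r hr hrm := by
    have hrd := (hd r).1 hrm
    dsimp only
    rcases le_or_gt r t with hrt | hrt
    · exact .inl ⟨r - 1, by omega, by omega⟩
    · exact .inr ⟨r - (t + 1), by omega, by omega⟩

lemma residueCover_high {d : ℕ} (hnq : n = q * m + t) (ht : t < m) (htm : m ≤ 2 * t)
    (hd : ∀ r, 2 * r < m ↔ r ≤ d) :
    ResidueCover n m ⟨1, q, q, m - 1 - t⟩ ⟨m - t, q + 1, q, d + t + 1 - m⟩ where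
  left s hs := by
    dsimp only at *
    exact residueChain_of_le_of_add_lt hnq (by omega) (by omega) (by omega) (by omega)
  right s hs := by
    dsimp only at *
    exact residueChain_of_le_add hnq ht (by omega) ((hd _).2 (by omega)) (by omega)
  disjoint s hs s' hs' := by
    dsimp only at *
    omega
  cover r hr hrm := by
    have hrd := (hd r).1 hrm
    dsimp only
    rcases lt_or_ge r (m - t) with hrt | hrt
    · exact .inl ⟨r - 1, by omega, by omega⟩
    · exact .inr ⟨r - (m - t), by omega, by omega⟩

end Cover

section RestVec

variable {V : Type*} [AddCommGroup V]

/-- The differences of consecutive unit vectors in the residue classes of `G`. -/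
def groupVec (ε : ℕ → V) (m : ℕ) (G : ResidueGroup) (z : Fin (G.l + G.p) × Fin G.c) : V :=
  stepVec (residueVec ε m (G.r + z.2) G.l) (G.l + G.p) z.1

/-- The roots of height `m` outside the residue class `m / 2`. -/
def restVec (X : Family) (ε : ℕ → V) (m q : ℕ) (G H : ResidueGroup) :
    (Fin (X.rank q) ⊕ Fin (G.l + G.p) × Fin G.c) ⊕ Fin (H.l + H.p) × Fin H.c → V :=
  Sum.elim (Sum.elim (chainVec X (fun c => ε (c * m)) q) (groupVec ε m G)) (groupVec ε m H)

/-- The Cartan matrix of the vectors `restVec`. -/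
def restMatrix (X : Family) (q : ℕ) (G H : ResidueGroup) :
    Matrix ((Fin (X.rank q) ⊕ Fin (G.l + G.p) × Fin G.c) ⊕ Fin (H.l + H.p) × Fin H.c)
      ((Fin (X.rank q) ⊕ Fin (G.l + G.p) × Fin G.c) ⊕ Fin (H.l + H.p) × Fin H.c) ℤ :=
  X.BD q ⊕ᴅ copies G.c (typeA (G.l + G.p)) ⊕ᴅ copies H.c (typeA (H.l + H.p))

lemma offDiagNonpos_restMatrix (X : Family) (q : ℕ) (G H : ResidueGroup) :
    OffDiagNonpos (restMatrix X q G H) :=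
  ((offDiagNonpos_BD X q).sum ((offDiagNonpos_A _).copies _)).sum ((offDiagNonpos_A _).copies _)

variable {n m q : ℕ} {G H : ResidueGroup}

lemma ResidueCover.exists_restVec_eq (X : Family) (ε : ℕ → V) (hGH : ResidueCover n m G H) {a : ℤ}
    {r : ℕ} (hr : 0 < r) (hrm : 2 * r < m) (hdvd : (m : ℤ) ∣ a - r) (hna : -(n : ℤ) ≤ a)
    (han : a + m ≤ n) : ∃ x, restVec X ε m q G H x = signed ε (a + m) - signed ε a := by
  rcases hGH.cover r hr hrm with ⟨s, hs, rfl⟩ | ⟨s, hs, rfl⟩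
  · obtain ⟨x, hx⟩ := (hGH.left s hs).exists_stepVec_eq (ε := ε) hdvd hna han
    exact ⟨.inl (.inr (x, ⟨s, hs⟩)), hx⟩
  · obtain ⟨x, hx⟩ := (hGH.right s hs).exists_stepVec_eq (ε := ε) hdvd hna han
    exact ⟨.inr (x, ⟨s, hs⟩), hx⟩

lemma ResidueCover.exists_restVec_mem_classSpan [Module ℝ V] (X : Family) (ε : ℕ → V)
    (hGH : ResidueCover n m G H) (hm : 1 ≤ m) (hq : 1 ≤ q) (hn : q * m ≤ n) (x) :
    ∃ r, 2 * r < m ∧ restVec X ε m q G H x ∈ classSpan ε n m r := by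
  rcases x with (x | x) | x
  · exact ⟨0, by omega, chainVec_mul_mem_classSpan X ε hq hn x⟩
  · have hchain := hGH.left x.2 x.2.2
    exact ⟨_, hchain.two_mul_lt, stepVec_residueVec_mem_classSpan ε hchain x.1⟩
  · have hchain := hGH.right x.2 x.2.2
    exact ⟨_, hchain.two_mul_lt, stepVec_residueVec_mem_classSpan ε hchain x.1⟩

end RestVec

section RestDiagram

variable {ι V N : Type*} [AddCommGroup V] [Module ℝ V] [AddCommGroup N] [Module ℝ N]
  {P : RootPairing ι ℝ V N} {b : P.Base} [P.IsRootSystem] {X : Family} {n : ℕ}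
  {e : Fin (X.rank n) ≃ b.support} {ε : ℕ → V} {g : V →ₗ[ℝ] V →ₗ[ℝ] ℝ} {m q : ℕ}
  {G H : ResidueGroup}

namespace Realization

variable (hR : Realization X n e ε g)

include hR

lemma represents_groupVec (hG : G.IsValid n m) :
    Represents g (groupVec ε m G) (copies G.c (typeA (G.l + G.p))) := by
  refine represents_copies
    (v := fun (s : Fin G.c) => stepVec (residueVec ε m (G.r + s) G.l) (G.l + G.p))
    (fun s => hR.represents_stepVec_residueVec (hG s s.2)) fun s s' x y hs => ?_
  have hchain := hG s s.2
  have hchain' := hG s' s'.2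
  exact hR.form_eq_zero_of_mem_classSpan hchain.two_mul_lt.le hchain'.two_mul_lt.le
    (fun h => hs (Fin.ext (Nat.add_left_cancel h)))
    (stepVec_residueVec_mem_classSpan ε hchain x) (stepVec_residueVec_mem_classSpan ε hchain' y)

lemma form_chainVec_groupVec (hG : G.IsValid n m) (hq : 1 ≤ q) (hn : q * m ≤ n)
    (x : Fin (X.rank q)) (y) : g (chainVec X (fun c => ε (c * m)) q x) (groupVec ε m G y) = 0 := by
  have hchain := hG y.2 y.2.2
  have hpos := hchain.pos
  exact hR.form_eq_zero_of_mem_classSpan (by omega) hchain.two_mul_lt.le (by omega)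
    (chainVec_mul_mem_classSpan X ε hq hn x) (stepVec_residueVec_mem_classSpan ε hchain y.1)

lemma form_groupVec_groupVec (hGH : ResidueCover n m G H) (x y) :
    g (groupVec ε m G x) (groupVec ε m H y) = 0 := by
  have hchain := hGH.left x.2 x.2.2
  have hchain' := hGH.right y.2 y.2.2
  exact hR.form_eq_zero_of_mem_classSpan hchain.two_mul_lt.le hchain'.two_mul_lt.le
    (hGH.disjoint _ x.2.2 _ y.2.2) (stepVec_residueVec_mem_classSpan ε hchain x.1)
    (stepVec_residueVec_mem_classSpan ε hchain' y.1)

lemma represents_restVec (hGH : ResidueCover n m G H) (hm : 1 ≤ m) (hq : 1 ≤ q)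
    (hn : q * m ≤ n) : Represents g (restVec X ε m q G H) (restMatrix X q G H) := by
  have hleft := hR.form_chainVec_groupVec hGH.left hq hn
  have hright (x y) : g (Sum.elim (chainVec X (fun c => ε (c * m)) q) (groupVec ε m G) x)
      (groupVec ε m H y) = 0 := by
    rcases x with x | x
    · exact hR.form_chainVec_groupVec hGH.right hq hn x y
    · exact hR.form_groupVec_groupVec hGH x y
  exact ((hR.represents_chainVec_mul hm hq hn).sum (hR.represents_groupVec hGH.left) hleft
    fun x y => (hR.form_comm _ _).trans (hleft x y)).sum (hR.represents_groupVec hGH.right) hright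
    fun x y => (hR.form_comm _ _).trans (hright x y)

lemma exists_root_restVec (hGH : ResidueCover n m G H) (hm : 1 ≤ m) (hq : 1 ≤ q)
    (hn : q * m ≤ n) (x) : ∃ i, b.height i = m ∧ P.root i = restVec X ε m q G H x := by
  rcases x with (x | x) | x
  · exact hR.exists_root_chainVec_mul hm hq hn x
  · exact hR.exists_root_stepVec_residueVec (hGH.left x.2 x.2.2) x.1
  · exact hR.exists_root_stepVec_residueVec (hGH.right x.2 x.2.2) x.1

lemma exists_restVec_eq_of_root_eq_add {t : ℕ} (hGH : ResidueCover n m G H)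
    (hnq : n = q * m + t) (ht : t < m) {i : ι} {a c : ℕ} (hac : a < c) (hc : c ≤ n)
    (hm : a + c = m) (hi : P.root i = ε c + ε a) : ∃ x, P.root i = restVec X ε m q G H x := by
  rcases Nat.eq_zero_or_pos a with rfl | ha
  · rw [zero_add] at hm
    subst hm
    obtain ⟨x, hx⟩ := hR.exists_chainVec_mul_eq hnq ht (dvd_zero c) (by rwa [zero_add])
      (.inr ⟨rfl, by rwa [zero_add]⟩)
    exact ⟨.inl (.inl x), hx⟩
  · obtain ⟨x, hx⟩ := hGH.exists_restVec_eq (q := q) X ε (a := -(c : ℤ)) ha (by omega)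
      ⟨-1, by omega⟩ (by omega) (by omega)
    have hcm : -(c : ℤ) + m = a := by omega
    refine ⟨x, ?_⟩
    rw [hx, hi, hcm, signed_neg_natCast ε (by omega), signed_natCast, sub_neg_eq_add, add_comm]

lemma exists_restVec_eq_or_of_root_eq_sub {t : ℕ} (hGH : ResidueCover n m G H)
    (hnq : n = q * m + t) (ht : t < m) {i : ι} {a : ℕ} (han : a + m ≤ n)
    (hi : P.root i = ε (a + m) - ε a) :
    (∃ x, P.root i = restVec X ε m q G H x) ∨ ∃ k c, m = 2 * k ∧ 1 ≤ c ∧ k + c * m ≤ n ∧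
      P.root i = ε (k + c * m) - ε (k + (c - 1) * m) := by
  obtain ⟨d, r, hr, rfl⟩ : ∃ d r, r < m ∧ a = r + d * m :=
    ⟨a / m, a % m, Nat.mod_lt a (by omega), (Nat.mod_add_div' a m).symm⟩
  rcases Nat.eq_zero_or_pos r with rfl | hr0
  · obtain ⟨x, hx⟩ := hR.exists_chainVec_mul_eq hnq ht (by simp) han (.inl hi)
    exact .inl ⟨.inl (.inl x), hx⟩
  rcases lt_trichotomy (2 * r) m with hlt | heq | hgt
  · obtain ⟨x, hx⟩ := hGH.exists_restVec_eq (q := q) X ε (a := (r + d * m : ℕ)) hr0 hlt (by simp)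
      (by omega) (by omega)
    exact .inl ⟨x, by rw [hx, hi, ← Nat.cast_add, signed_natCast, signed_natCast]⟩
  · rw [add_assoc, ← add_one_mul] at han hi
    exact .inr ⟨r, d + 1, heq.symm, Nat.le_add_left _ _, han, hi⟩
  -- The root is also `ε_{-a} - ε_{-a-m}`, where `-a - m ≡ m - r` and `m - r < m / 2`.
  · obtain ⟨x, hx⟩ := hGH.exists_restVec_eq (q := q) X ε (r := m - r)
      (a := -((r + d * m + m : ℕ) : ℤ)) (by omega) (by omega)
      ⟨-(d + 2), by push_cast [Nat.cast_sub hr.le]; ring⟩ (by omega) (by omega)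
    have ham : -((r + d * m + m : ℕ) : ℤ) + m = -(r + d * m : ℕ) := by push_cast; ring
    refine .inl ⟨x, ?_⟩
    rw [hx, hi, ham, signed_neg_natCast ε (by omega), signed_neg_natCast ε (by omega),
      neg_sub_neg]

lemma exists_restVec_eq_or_of_height_eq [Finite ι] [P.IsCrystallographic] [P.IsReduced] {t : ℕ}
    (hGH : ResidueCover n m G H) (hnq : n = q * m + t) (ht : t < m) {i : ι}
    (hi : b.height i = m) :
    (∃ x, P.root i = restVec X ε m q G H x) ∨ ∃ k c, m = 2 * k ∧ 1 ≤ c ∧ k + c * m ≤ n ∧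
      P.root i = ε (k + c * m) - ε (k + (c - 1) * m) := by
  obtain ⟨a, c, hac, hc, h | h⟩ := hR.root_of_isPos (i := i) (by rw [Base.isPos_iff, hi]; omega)
  · have hheight := hR.height_of_root_eq_sub (a := c) (c := a) (by omega) (by omega)
      (by simpa only [signed_natCast] using h)
    obtain rfl : c = a + m := by omega
    exact hR.exists_restVec_eq_or_of_root_eq_sub hGH hnq ht hc h
  · have hheight := hR.height_of_root_eq_add hc (by omega) h
    exact .inl (hR.exists_restVec_eq_of_root_eq_add hGH hnq ht hac hc (by omega) h)

end Realization

end RestDiagram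

/-! ### Levi type -/

section Levi

variable {m n : ℕ}

lemma bmod_sub_bmod_eq_zero_iff (a c : ℤ) : c.bmod m - a.bmod m = 0 ↔ (m : ℤ) ∣ c - a := by
  rw [sub_eq_zero, Int.bmod_eq_bmod_iff_bmod_sub_eq_zero, Int.dvd_iff_bmod_eq_zero]

lemma bmod_add_bmod_eq_zero_iff {a c : ℤ} (h : (m : ℤ) ∣ 2 * a → (m : ℤ) ∣ c + a → (m : ℤ) ∣ a) :
    c.bmod m + a.bmod m = 0 ↔ (m : ℤ) ∣ c + a := by
  have hdvd : c.bmod m + a.bmod m = 0 → (m : ℤ) ∣ c + a := fun h0 => by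
    have := (Int.dvd_bmod_sub_self (x := c) (m := m)).add (Int.dvd_bmod_sub_self (x := a) (m := m))
    rwa [sub_add_sub_comm, h0, zero_sub, dvd_neg] at this
  refine ⟨hdvd, fun hca => ?_⟩
  rw [← sub_neg_eq_add] at hca
  by_cases ha : (m : ℤ) ∣ 2 * a
  · have ha' := h ha (by rwa [← sub_neg_eq_add])
    rw [sub_neg_eq_add, Int.dvd_add_left ha'] at hca
    rw [Int.dvd_iff_bmod_eq_zero.mp hca, Int.dvd_iff_bmod_eq_zero.mp ha', add_zero]
  · have hsub := (bmod_sub_bmod_eq_zero_iff _ _).mpr hca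
    rwa [Int.neg_bmod, if_neg ha, sub_neg_eq_add] at hsub

lemma dvd_of_dvd_two_mul_of_dvd_add (h : ∀ k, m = 2 * k → n < 3 * k) {a c : ℕ} (hac : a < c)
    (hc : c ≤ n) (ha : m ∣ 2 * a) (hca : m ∣ c + a) : m ∣ a := by
  obtain ⟨d, hd⟩ := ha
  have hm : m ≤ c - a := by
    refine Nat.le_of_dvd (by omega) ?_
    rw [← Nat.add_sub_add_right c a a, ← two_mul, hd]
    exact Nat.dvd_sub hca (dvd_mul_right m d)
  obtain ⟨d, rfl | rfl⟩ := d.even_or_odd'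
  · exact ⟨d, by linarith⟩
  · have := h (a - m * d) (by rw [mul_add] at hd; lia)
    rw [mul_add] at hd
    lia

variable {ι V N : Type*} [AddCommGroup V] [Module ℝ V] [AddCommGroup N] [Module ℝ N]
  {P : RootPairing ι ℝ V N} {b : P.Base}

lemma rootsMult_eq_setOf_root'_eq_zero {φ : N}
    (h : ∀ i, b.IsPos i → (i ∈ rootsMult b m ↔ P.root' i φ = 0)) :
    rootsMult b m = {i | P.root' i φ = 0} := by
  ext i
  rcases Base.IsPos.or_neg b i with hi | hi
  · exact h i hi
  · have hneg : P.reflectionPerm i i ∈ rootsMult b m ↔ P.root' (P.reflectionPerm i i) φ = 0 :=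
      h _ hi
    have hroot : P.root' (P.reflectionPerm i i) φ = -P.root' i φ := by
      change P.toLinearMap (P.root (P.reflectionPerm i i)) φ = -P.toLinearMap (P.root i) φ
      rw [root_reflectionPerm_self, map_neg, LinearMap.neg_apply]
    rw [hroot, neg_eq_zero] at hneg
    rw [Set.mem_ofPred_eq, ← hneg]
    refine ⟨reflectionPerm_self_mem_rootsMult b m, fun hi' => ?_⟩
    have hheight : b.height (P.reflectionPerm i i) = -b.height i :=
      Base.height_reflectionPerm_self ..
    rwa [rootsMult, Set.mem_ofPred_eq, hheight, dvd_neg] at hi'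

variable [P.IsRootSystem] {X : Family} {e : Fin (X.rank n) ≃ b.support} {ε : ℕ → V}
  {g : V →ₗ[ℝ] V →ₗ[ℝ] ℝ} {q : ℕ} {G H : ResidueGroup}

namespace Realization

variable (hR : Realization X n e ε g)

include hR

lemma exists_functional (w : ℕ → ℝ) (hw : w 0 = 0) :
    ∃ φ : V →ₗ[ℝ] ℝ, ∀ c ≤ n, φ (ε c) = w c := by
  refine ⟨∑ a ∈ Finset.range (n + 1), w a • g (ε a), fun c hc => ?_⟩
  have hterm : ∀ a ∈ Finset.range (n + 1), (w a • g (ε a)) (ε c) = if a = c then w c else 0 := by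
    intro a ha
    rw [LinearMap.smul_apply, hR.form_eps a c (Finset.mem_range_succ_iff.mp ha) hc]
    split_ifs with hac
    · rcases Nat.eq_zero_or_pos c with rfl | hc0
      · rw [hac, hw, zero_smul]
      · rw [hac, X.sqLength_of_pos hc0, smul_eq_mul, mul_one]
    · exact smul_zero _
  rw [LinearMap.sum_apply, Finset.sum_congr rfl hterm, Finset.sum_ite_eq',
    if_pos (Finset.mem_range_succ_iff.mpr hc)]

lemma exists_coweight (w : ℕ → ℝ) (hw : w 0 = 0) :
    ∃ φ : N, ∀ c ≤ n, P.toLinearMap (ε c) φ = w c := by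
  obtain ⟨φ, hφ⟩ := hR.exists_functional w hw
  obtain ⟨x, rfl⟩ := (LinearMap.IsPerfPair.bijective_right P.toLinearMap).2 φ
  exact ⟨x, hφ⟩

/-- `R(m)` is the set of roots orthogonal to the coweight whose coordinates are the balanced
residues modulo `m`. -/
lemma isLeviType_rootsMult [Finite ι] [P.IsCrystallographic] [P.IsReduced]
    (h : ∀ k, m = 2 * k → n < 3 * k) : IsLeviType b (rootsMult b m) := by
  obtain ⟨φ, hφ⟩ := hR.exists_coweight (fun a => ((a : ℤ).bmod m : ℝ)) (by simp)
  rw [rootsMult_eq_setOf_root'_eq_zero (φ := φ)]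
  · exact isLeviType_setOf_root'_eq_zero b φ
  intro i hi
  change (m : ℤ) ∣ b.height i ↔ P.toLinearMap (P.root i) φ = 0
  obtain ⟨a, c, hac, hc, hroot | hroot⟩ := hR.root_of_isPos hi
  · rw [hR.height_of_root_eq_sub (a := c) (c := a) (by omega) (by omega)
      (by simpa only [signed_natCast] using hroot), hroot, map_sub, LinearMap.sub_apply, hφ c hc,
      hφ a (by omega), ← bmod_sub_bmod_eq_zero_iff]
    norm_cast
  · have hdvd := dvd_of_dvd_two_mul_of_dvd_add h hac hc
    rw [hR.height_of_root_eq_add hc (by omega) hroot, hroot, map_add, LinearMap.add_apply, hφ c hc,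
      hφ a (by omega), ← bmod_add_bmod_eq_zero_iff (by exact_mod_cast hdvd)]
    norm_cast

lemma eps_mem_span_rootsMult {a c : ℕ} (hac : a < c) (hc : c ≤ n) (hsub : m ∣ c - a)
    (hadd : m ∣ c + a) : ε c ∈ Submodule.span ℝ (P.root '' rootsMult b m) ∧
      ε a ∈ Submodule.span ℝ (P.root '' rootsMult b m) := by
  obtain ⟨i, hi⟩ := hR.exists_root_sub hac hc
  obtain ⟨j, hj⟩ := hR.exists_root_add hac hc
  have him : i ∈ rootsMult b m := by
    rw [rootsMult, Set.mem_ofPred_eq, hR.height_of_root_eq_sub (a := c) (c := a) (by omega)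
      (by omega) (by simpa only [signed_natCast] using hi), ← Nat.cast_sub hac.le]
    exact_mod_cast hsub
  have hjm : j ∈ rootsMult b m := by
    rw [rootsMult, Set.mem_ofPred_eq, hR.height_of_root_eq_add hc (by omega) hj]
    exact_mod_cast hadd
  have hi_span := Submodule.subset_span (R := ℝ) (Set.mem_image_of_mem P.root him)
  have hj_span := Submodule.subset_span (R := ℝ) (Set.mem_image_of_mem P.root hjm)
  rw [hi] at hi_span
  rw [hj] at hj_span
  constructor
  · convert Submodule.smul_mem _ (1 / 2 : ℝ) (add_mem hi_span hj_span) using 1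
    module
  · convert Submodule.smul_mem _ (1 / 2 : ℝ) (sub_mem hj_span hi_span) using 1
    module

/-- The root `ε_{2k} + ε_k` of height `3k` is in the span of `R(2k)`. -/
lemma not_isLeviType_rootsMult [Finite ι] [P.IsCrystallographic] [P.IsReduced] {k : ℕ}
    (hk : 1 ≤ k) (hkn : 3 * k ≤ n) : ¬ IsLeviType b (rootsMult b (2 * k)) := by
  intro hL
  obtain ⟨i, hi⟩ := hR.exists_root_add (a := k) (c := 2 * k) (by omega) (by omega)
  have hspan := (hR.eps_mem_span_rootsMult (m := 2 * k) (a := 0) (c := 2 * k) (by omega) (by omega)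
    (by simp) (by simp)).1
  have hspan' := (hR.eps_mem_span_rootsMult (m := 2 * k) (a := k) (by omega) hkn
    ⟨1, by omega⟩ ⟨2, by omega⟩).2
  have hmem : ((2 * k : ℕ) : ℤ) ∣ b.height i := hL.mem_of_mem_span (hi ▸ add_mem hspan hspan')
  rw [hR.height_of_root_eq_add (by omega) (by omega) hi] at hmem
  have hdvd : 2 * k ∣ k := (Nat.dvd_add_right dvd_rfl).1 (by exact_mod_cast hmem)
  have := Nat.le_of_dvd hk hdvd
  omega

lemma hasType_rootsMult [Finite ι] [P.IsCrystallographic] [P.IsReduced] {t : ℕ}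
    (hGH : ResidueCover n m G H) (hm : 1 ≤ m) (hq : 1 ≤ q) (hnq : n = q * m + t) (ht : t < m)
    (h : ∀ k, m = 2 * k → n < 3 * k) : HasType P (rootsMult b m) (restMatrix X q G H) := by
  refine ⟨_, isBaseOf_simpleRootsMult b m, hR.hasDiagram_of_represents
    (hR.represents_restVec hGH hm hq (by omega)) (offDiagNonpos_restMatrix X q G H) ?_⟩
  ext v
  constructor
  · rintro ⟨i, hi, rfl⟩
    rcases hR.height_or_root_of_mem_simpleRootsMult hm hi with hi | ⟨k, hk, hkn, -⟩
    · rcases hR.exists_restVec_eq_or_of_height_eq hGH hnq ht hi with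
        ⟨x, hx⟩ | ⟨k, c, hk, hc, hkn, -⟩
      · exact ⟨x, hx.symm⟩
      · have := h k hk
        have := Nat.le_mul_of_pos_left m hc
        omega
    · exact absurd (h k hk) hkn.not_gt
  · rintro ⟨x, rfl⟩
    obtain ⟨i, hi, hi'⟩ := hR.exists_root_restVec hGH hm hq (by omega) x
    exact ⟨i, mem_simpleRootsMult_of_height hm hi, hi'⟩

end Realization

end Levi

/-! ### The residue class `m / 2` -/

/-- For `m = 2 * k`, the elements of `[0, n]` congruent to `k` modulo `m` are the integers
`k + c * m` with `c ≤ p`; there are at least two of them, so that they contribute a type `D`. -/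
structure HalfClass (n m k p : ℕ) : Prop where
  eq_two_mul : m = 2 * k
  pos : 1 ≤ k
  one_le : 1 ≤ p
  upper : k + p * m ≤ n
  upper_max : n < k + (p + 1) * m

namespace HalfClass

variable {n m k p : ℕ} (h : HalfClass n m k p)

include h

lemma add_mul_le {c : ℕ} (hc : c ≤ p) : k + c * m ≤ n := h.upper.trans' (by gcongr)

lemma le_of_add_mul_le {c : ℕ} (hc : k + c * m ≤ n) : c ≤ p := by
  by_contra! hpc
  have : (p + 1) * m ≤ c * m := by gcongr; exact hpc
  have := h.upper_max
  omega

lemma three_mul_le : 3 * k ≤ n := by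
  have := h.add_mul_le h.one_le
  have := h.eq_two_mul
  omega

lemma one_le_m : 1 ≤ m := by
  have := h.eq_two_mul
  have := h.pos
  omega

end HalfClass

lemma range_chainVec_D {V : Type*} [AddCommGroup V] (u : ℕ → V) (p : ℕ) :
    Set.range (chainVec .D u p) = Set.range (stepVec u p) ∪ {u 1 + u 0} := by
  ext v
  constructor
  · rintro ⟨x, rfl⟩
    have hx : (x : ℕ) < p + 1 := x.2
    unfold chainVec
    split_ifs with hxp
    · exact .inr rfl
    · refine .inl ⟨⟨p - x - 1, by omega⟩, ?_⟩
      rw [stepVec, Nat.sub_add_cancel (by omega)]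
  · rintro (⟨x, rfl⟩ | rfl)
    · refine ⟨⟨p - (x + 1), Nat.lt_succ_of_le (Nat.sub_le _ _)⟩, ?_⟩
      rw [chainVec, if_neg (by dsimp only; omega), stepVec,
        Nat.sub_sub_self (show (x : ℕ) + 1 ≤ p from x.2), Nat.add_sub_cancel]
    · exact ⟨⟨p, Nat.lt_succ_self p⟩, if_pos rfl⟩

section Table

variable {ι V N : Type*} [AddCommGroup V] [Module ℝ V] [AddCommGroup N] [Module ℝ N]
  {P : RootPairing ι ℝ V N} {b : P.Base}

/-- The unit vectors `ε_a` with `a` congruent to `k` modulo `m`. -/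
abbrev halfVec (ε : ℕ → V) (m k : ℕ) (c : ℕ) : V := ε (k + c * m)

variable [P.IsRootSystem] {X : Family} {n : ℕ} {e : Fin (X.rank n) ≃ b.support}
  {ε : ℕ → V} {g : V →ₗ[ℝ] V →ₗ[ℝ] ℝ} {m k p q t : ℕ} {G H : ResidueGroup}

namespace Realization

variable (hR : Realization X n e ε g)

include hR

lemma sum_simpleRoot {a c : ℕ} (hac : a ≤ c) (hc : c ≤ n) :
    ∑ j ∈ Finset.Icc (a + 1) c, simpleRoot X n e j = ε c - ε a := by
  induction c, hac using Nat.le_induction with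
  | base => rw [Finset.Icc_eq_empty (by omega), Finset.sum_empty, sub_self]
  | succ c hac ih =>
    rw [Finset.sum_Icc_succ_top (by omega), ih (by omega), hR.simple_succ _ (by omega) hc,
      Nat.add_sub_cancel, add_comm, sub_add_sub_cancel]

lemma deltaRoot_eq (hk : 1 ≤ k) (hkn : 3 * k ≤ n) : deltaRoot X n e k = ε (3 * k) + ε k := by
  have hupper := hR.sum_simpleRoot (a := k) (c := 3 * k) (by omega) hkn
  cases X with
  | B =>
    have hlower := hR.sum_simpleRoot (a := 0) (c := k) (by omega) (by omega)
    rw [zero_add, hR.eps_zero rfl] at hlower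
    rw [deltaRoot, hupper, hlower]
    module
  | D =>
    rw [deltaRoot, hupper, hR.sum_simpleRoot (a := 1) (c := k) hk (by omega), hR.simple_zero rfl,
      hR.simple_succ 1 le_rfl (by omega)]
    module

lemma mem_chainRoots_iff (h : HalfClass n m k p) {i : ι} : i ∈ chainRoots X n e m k p ↔
    ∃ c < p, P.root i = halfVec ε m k (c + 1) - halfVec ε m k c := by
  have hsum (c : ℕ) (hc : c < p) : ∑ j ∈ Finset.Icc (k + c * m + 1) (k + (c + 1) * m),
      simpleRoot X n e j = halfVec ε m k (c + 1) - halfVec ε m k c :=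
    hR.sum_simpleRoot (by gcongr; omega) (h.add_mul_le hc)
  constructor
  · rintro ⟨c, hc1, hcp, hc⟩
    obtain ⟨c, rfl⟩ := Nat.exists_eq_add_of_le' hc1
    exact ⟨c, hcp, hc.trans (hsum c hcp)⟩
  · rintro ⟨c, hcp, hc⟩
    exact ⟨c + 1, c.succ_pos, hcp, hc.trans (hsum c hcp).symm⟩

lemma orthogonalUpTo_halfVec (h : HalfClass n m k p) : OrthogonalUpTo g (halfVec ε m k) p 1 := by
  intro a c ha hc
  have hm := h.one_le_m
  have hk := h.pos
  rw [hR.form_eps _ _ (h.add_mul_le ha) (h.add_mul_le hc), X.sqLength_of_pos (by omega)]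
  simp only [Nat.add_left_cancel_iff, Nat.mul_left_inj (Nat.one_le_iff_ne_zero.mp hm), Pi.one_apply]

lemma orthogonalUpTo_halfVec_sqLength (h : HalfClass n m k p) :
    OrthogonalUpTo g (halfVec ε m k) p Family.D.sqLength :=
  Family.sqLength_D ▸ hR.orthogonalUpTo_halfVec h

lemma represents_chainVec_halfVec (h : HalfClass n m k p) :
    Represents g (chainVec .D (halfVec ε m k) p) (typeD (p + 1)) :=
  (hR.orthogonalUpTo_halfVec_sqLength h).represents_chainVec_D h.one_le

lemma exists_chainRoot (h : HalfClass n m k p) {c : ℕ} (hc : c < p) :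
    ∃ i, b.height i = m ∧ P.root i = halfVec ε m k (c + 1) - halfVec ε m k c := by
  have hkc : k + (c + 1) * m ≤ n := h.add_mul_le hc
  rw [add_one_mul, ← add_assoc] at hkc
  obtain ⟨i, hi, hroot⟩ := hR.exists_root_eps_add_sub h.one_le_m hkc
  exact ⟨i, hi, by rw [hroot, halfVec, halfVec, add_one_mul, add_assoc]⟩

lemma height_of_mem_chainRoots (h : HalfClass n m k p) {i : ι}
    (hi : i ∈ chainRoots X n e m k p) : b.height i = m := by
  obtain ⟨c, hcp, hc⟩ := (hR.mem_chainRoots_iff h).1 hi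
  obtain ⟨j, hj, hj'⟩ := hR.exists_chainRoot h hcp
  rwa [P.root.injective (hc.trans hj'.symm)]

lemma exists_delta [Finite ι] [P.IsCrystallographic] [P.IsReduced] (h : HalfClass n m k p) :
    ∃ δ, P.root δ = deltaRoot X n e k ∧ P.root δ = halfVec ε m k 1 + halfVec ε m k 0 ∧
      b.height δ = 2 * m ∧ simpleRootsMult b m = rootsHeight b m ∪ {δ} := by
  have hmk := h.eq_two_mul
  have hkn := h.three_mul_le
  obtain ⟨δ, hδ⟩ := hR.exists_root_add (a := k) (by have := h.pos; omega) hkn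
  refine ⟨δ, by rw [hδ, hR.deltaRoot_eq h.pos hkn], ?_, ?_, ?_⟩
  · rw [hδ, halfVec, halfVec, zero_mul, one_mul, show k + m = 3 * k by omega, add_zero]
  · rw [hR.height_of_root_eq_add hkn (by omega) hδ]
    omega
  ext i
  constructor
  · intro hi
    rcases hR.height_or_root_of_mem_simpleRootsMult h.one_le_m hi with hi | ⟨k', hk', -, hi⟩
    · exact .inl hi
    · obtain rfl : k' = k := by omega
      exact .inr (P.root.injective (hi.trans hδ.symm))
  · rintro (hi | rfl)
    · exact mem_simpleRootsMult_of_height h.one_le_m hi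
    · exact hmk ▸ hR.delta_mem_simpleRootsMult h.pos hkn hδ

lemma image_chainRoots (h : HalfClass n m k p) :
    P.root '' chainRoots X n e m k p = Set.range (stepVec (halfVec ε m k) p) := by
  ext v
  constructor
  · rintro ⟨i, hi, rfl⟩
    obtain ⟨c, hcp, hc⟩ := (hR.mem_chainRoots_iff h).1 hi
    exact ⟨⟨c, hcp⟩, hc.symm⟩
  · rintro ⟨x, rfl⟩
    obtain ⟨i, -, hi⟩ := hR.exists_chainRoot h x.2
    exact ⟨i, (hR.mem_chainRoots_iff h).2 ⟨x, x.2, hi⟩, hi⟩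

lemma image_dagger (h : HalfClass n m k p) {δ : ι}
    (hδ : P.root δ = halfVec ε m k 1 + halfVec ε m k 0) :
    P.root '' (chainRoots X n e m k p ∪ {δ}) = Set.range (chainVec .D (halfVec ε m k) p) := by
  rw [Set.image_union, hR.image_chainRoots h, Set.image_singleton, hδ, range_chainVec_D]

lemma dagger_mem_classSpan (h : HalfClass n m k p) {δ i : ι}
    (hδ : P.root δ = halfVec ε m k 1 + halfVec ε m k 0) (hi : i ∈ chainRoots X n e m k p ∪ {δ}) :
    P.root i ∈ classSpan ε n m k := by
  obtain ⟨x, hx⟩ := hR.image_dagger h hδ ▸ Set.mem_image_of_mem P.root hi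
  exact hx ▸ chainVec_add_mul_mem_classSpan .D ε h.one_le h.upper x

lemma mem_dagger_or_exists_restVec_eq [Finite ι] [P.IsCrystallographic] [P.IsReduced]
    (h : HalfClass n m k p) (hGH : ResidueCover n m G H) (hnq : n = q * m + t) (ht : t < m)
    {δ i : ι} (hΓ : simpleRootsMult b m = rootsHeight b m ∪ {δ}) (hi : i ∈ simpleRootsMult b m) :
    i ∈ chainRoots X n e m k p ∪ {δ} ∨ ∃ x, P.root i = restVec X ε m q G H x := by
  rw [hΓ] at hi
  rcases hi with hi | hi
  · rcases hR.exists_restVec_eq_or_of_height_eq hGH hnq ht hi with hx | ⟨k', c, hk', hc, hcn, hroot⟩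
    · exact .inr hx
    · obtain rfl : k' = k := by have := h.eq_two_mul; omega
      obtain ⟨c, rfl⟩ := Nat.exists_eq_add_of_le' hc
      exact .inl (.inl ((hR.mem_chainRoots_iff h).2 ⟨c, h.le_of_add_mul_le hcn, hroot⟩))
  · exact .inl (.inr hi)

lemma form_restVec_eq_zero (h : HalfClass n m k p) (hGH : ResidueCover n m G H) (hq : 1 ≤ q)
    (hn : q * m ≤ n) (x) {v : V} (hv : v ∈ classSpan ε n m k) :
    g (restVec X ε m q G H x) v = 0 := by
  obtain ⟨r, hr, hx⟩ := hGH.exists_restVec_mem_classSpan X ε h.one_le_m hq hn x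
  have := h.eq_two_mul
  exact hR.form_eq_zero_of_mem_classSpan hr.le (by omega) (by omega) hx hv

lemma image_simpleRootsMult_sdiff [Finite ι] [P.IsCrystallographic] [P.IsReduced]
    (h : HalfClass n m k p) (hGH : ResidueCover n m G H) (hq : 1 ≤ q) (hnq : n = q * m + t)
    (ht : t < m) {δ : ι} (hδ : P.root δ = halfVec ε m k 1 + halfVec ε m k 0)
    (hΓ : simpleRootsMult b m = rootsHeight b m ∪ {δ}) :
    P.root '' (simpleRootsMult b m \ (chainRoots X n e m k p ∪ {δ})) =
      Set.range (restVec X ε m q G H) := by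
  ext v
  constructor
  · rintro ⟨i, hi, rfl⟩
    obtain ⟨x, hx⟩ :=
      (hR.mem_dagger_or_exists_restVec_eq h hGH hnq ht hΓ hi.1).resolve_left hi.2
    exact ⟨x, hx.symm⟩
  · rintro ⟨x, rfl⟩
    obtain ⟨i, hi, hi'⟩ := hR.exists_root_restVec hGH h.one_le_m hq (by omega) x
    refine ⟨i, ⟨mem_simpleRootsMult_of_height h.one_le_m hi, fun hdagger => ?_⟩, hi'⟩
    have hself := hR.form_restVec_eq_zero h hGH hq (by omega) x
      (hR.dagger_mem_classSpan h hδ hdagger)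
    rw [← hi'] at hself
    exact (hR.form_root_pos i).ne' hself

lemma dagger_subset_simpleRootsMult (h : HalfClass n m k p) {δ : ι}
    (hΓ : simpleRootsMult b m = rootsHeight b m ∪ {δ}) :
    chainRoots X n e m k p ∪ {δ} ⊆ simpleRootsMult b m := by
  rw [hΓ]
  exact Set.union_subset_union_left _ fun i hi => hR.height_of_mem_chainRoots h hi

section

variable [Finite ι] [P.IsCrystallographic] [P.IsReduced]

lemma pairing_eq_zero_iff (i j : ι) : P.pairing i j = 0 ↔ g (P.root i) (P.root j) = 0 := by
  rw [← mul_left_inj' (hR.form_root_pos j).ne', hR.pairing_mul, zero_mul,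
    mul_eq_zero_iff_left two_ne_zero]

lemma isOrthogonal_iff (i j : ι) : P.IsOrthogonal i j ↔ g (P.root i) (P.root j) = 0 := by
  rw [IsOrthogonal, hR.pairing_eq_zero_iff, hR.pairing_eq_zero_iff, hR.form_comm (P.root j),
    and_self_iff]

lemma mem_component_of_form_ne_zero {S : Set ι} {δ i j : ι} (hi : i ∈ component P S δ)
    (hj : j ∈ S) (hij : g (P.root i) (P.root j) ≠ 0) : j ∈ component P S δ :=
  hi.tail ⟨hj, mt (hR.pairing_eq_zero_iff i j).1 hij⟩

lemma dagger_subset_component (h : HalfClass n m k p) (hp : 2 ≤ p) {δ : ι}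
    (hδ : P.root δ = halfVec ε m k 1 + halfVec ε m k 0)
    (hΓ : simpleRootsMult b m = rootsHeight b m ∪ {δ}) :
    chainRoots X n e m k p ∪ {δ} ⊆ component P (simpleRootsMult b m) δ := by
  have hu := hR.orthogonalUpTo_halfVec h
  have hδ_mem : δ ∈ component P (simpleRootsMult b m) δ := Relation.ReflTransGen.refl
  -- The chain is attached to `δ` by its second root.
  have htail : ∀ c, 1 ≤ c → c < p → ∀ i, b.height i = m →
      P.root i = halfVec ε m k (c + 1) - halfVec ε m k c →
      i ∈ component P (simpleRootsMult b m) δ := by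
    intro c hc_pos
    induction c, hc_pos using Nat.le_induction with
    | base =>
      intro _ i hi hroot
      refine hR.mem_component_of_form_ne_zero hδ_mem (hΓ ▸ .inl hi) ?_
      have hfork :=
        (hR.orthogonalUpTo_halfVec_sqLength h).apply_fork_chain (y := p - 2) (by omega)
      rw [if_pos (by omega), Nat.sub_sub_self hp] at hfork
      rw [hδ, hroot, hfork]
      norm_num
    | succ c _ ih =>
      intro hcp i hi hroot
      obtain ⟨j, hj, hj'⟩ := hR.exists_chainRoot h (c := c) (by omega)
      refine hR.mem_component_of_form_ne_zero (ih (by omega) j hj hj') (hΓ ▸ .inl hi) ?_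
      rw [hj', hroot, hu.apply_sub_sub (by omega) hcp, if_neg (by omega), if_neg (by omega),
        if_pos rfl]
      norm_num
  rintro i (hi | rfl)
  · obtain ⟨c, hcp, hc⟩ := (hR.mem_chainRoots_iff h).1 hi
    have hheight := hR.height_of_mem_chainRoots h hi
    rcases Nat.eq_zero_or_pos c with rfl | hc0
    · obtain ⟨j, hj, hj'⟩ := hR.exists_chainRoot h (c := 1) hp
      refine hR.mem_component_of_form_ne_zero (htail 1 le_rfl hp j hj hj') (hΓ ▸ .inl hheight) ?_
      rw [hj', hc, hu.apply_sub_sub hp hcp, if_neg one_ne_zero, if_pos rfl]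
      norm_num
    · exact htail c hc0 hcp i hheight hc
  · exact hδ_mem

lemma isOrthogonal_of_mem_dagger (h : HalfClass n m k p) (hGH : ResidueCover n m G H)
    (hq : 1 ≤ q) (hnq : n = q * m + t) (ht : t < m) {δ : ι}
    (hδ : P.root δ = halfVec ε m k 1 + halfVec ε m k 0)
    (hΓ : simpleRootsMult b m = rootsHeight b m ∪ {δ}) {i j : ι}
    (hi : i ∈ chainRoots X n e m k p ∪ {δ})
    (hj : j ∈ simpleRootsMult b m \ (chainRoots X n e m k p ∪ {δ})) : P.IsOrthogonal i j := by
  obtain ⟨x, hx⟩ := (hR.mem_dagger_or_exists_restVec_eq h hGH hnq ht hΓ hj.1).resolve_left hj.2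
  rw [hR.isOrthogonal_iff, hR.form_comm, hx]
  exact hR.form_restVec_eq_zero h hGH hq (by omega) x (hR.dagger_mem_classSpan h hδ hi)

lemma dagger_eq_component (h : HalfClass n m k p) (hGH : ResidueCover n m G H) (hq : 1 ≤ q)
    (hnq : n = q * m + t) (ht : t < m) (hp : 2 ≤ p) {δ : ι}
    (hδ : P.root δ = halfVec ε m k 1 + halfVec ε m k 0)
    (hΓ : simpleRootsMult b m = rootsHeight b m ∪ {δ}) :
    chainRoots X n e m k p ∪ {δ} = component P (simpleRootsMult b m) δ := by
  refine (hR.dagger_subset_component h hp hδ hΓ).antisymm fun i hi => ?_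
  induction hi with
  | refl => exact .inr rfl
  | tail _ hj ih =>
    by_contra hj'
    exact hj.2 (hR.isOrthogonal_of_mem_dagger h hGH hq hnq ht hδ hΓ ih ⟨hj.1, hj'⟩).1

end

lemma tableRow_of_dimConst [Fintype ι] [P.IsCrystallographic] [P.IsReduced]
    (h : HalfClass n m k p) (hGH : ResidueCover n m G H) (hq : 1 ≤ q)
    (hnq : n = q * m + t) (ht : t < m) (hdim : dimConst b m = 2 ^ p) :
    TableRow X n e m k p (restMatrix X q G H) := by
  obtain ⟨δ, hδ, hδ', hheight, hΓ⟩ := hR.exists_delta h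
  have hsub := hR.dagger_subset_simpleRootsMult h hΓ
  have hrest := hR.represents_restVec hGH h.one_le_m hq (by omega)
  have hdagger := hR.represents_chainVec_halfVec h
  have hzero (x y) : g (restVec X ε m q G H x) (chainVec .D (halfVec ε m k) p y) = 0 :=
    hR.form_restVec_eq_zero h hGH hq (by omega) x
      (chainVec_add_mul_mem_classSpan .D ε h.one_le h.upper y)
  have himage := hR.image_simpleRootsMult_sdiff h hGH hq hnq ht hδ' hΓ
  have himage_dagger := hR.image_dagger h hδ'
  refine ⟨δ, hδ, hheight, hΓ, isBaseOf_simpleRootsMult b m, ?_, _, rfl, hsub,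
    fun i hi j hj => hR.isOrthogonal_of_mem_dagger h hGH hq hnq ht hδ' hΓ hi hj,
    fun hp => hR.dagger_eq_component h hGH hq hnq ht hp hδ' hΓ,
    hR.hasDiagram_of_represents hrest (offDiagNonpos_restMatrix X q G H) himage,
    hR.hasDiagram_of_represents hdagger (offDiagNonpos_BD .D p) himage_dagger, ?_, hdim⟩
  · refine hR.hasDiagram_of_represents
      (hrest.sum hdagger hzero fun x y => (hR.form_comm _ _).trans (hzero x y))
      ((offDiagNonpos_restMatrix X q G H).sum (offDiagNonpos_BD .D p)) ?_
    refine Eq.trans ?_ (Set.Sum.elim_range _ (chainVec .D (halfVec ε m k) p)).symm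
    rw [← himage, ← himage_dagger, ← Set.image_union, Set.sdiff_union_of_subset hsub]
  · have hδ_notMem : δ ∉ chainRoots X n e m k p := fun hδ_mem => by
      have := hR.height_of_mem_chainRoots h hδ_mem
      have := h.one_le_m
      omega
    rw [Set.union_singleton, Set.insert_sdiff_self_of_notMem hδ_notMem]
    exact hR.hasDiagram_of_represents (hR.orthogonalUpTo_halfVec h).represents_stepVec
      (offDiagNonpos_A p) (hR.image_chainRoots h)

end Realization

end Table

/-! ### The constant `d_m` -/

lemma mod_eq_of_dvd_add {m k a c : ℕ} (hm : m = 2 * k) (hk : 1 ≤ k) (h : m ∣ c + a)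
    (ha : a % m = k) : c % m = k := by
  have hkm : k % m = k := Nat.mod_eq_of_lt (by omega)
  have hak : a ≡ k [MOD m] := ha.trans hkm.symm
  have hsum : c + a ≡ k + k [MOD m] :=
    (Nat.modEq_zero_iff_dvd.2 h).trans (Nat.modEq_zero_iff_dvd.2 ⟨1, by omega⟩).symm
  exact Eq.trans (Nat.ModEq.add_right_cancel hak hsum) hkm

/-- The values at the unit vectors of the functional that is `1` on the simple roots of `R(m)`,
where `m = 2 * k`. -/
noncomputable def halfWeight (m k a : ℕ) : ℝ := (if a % m = k then (a : ℝ) - k else a) / m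

lemma halfWeight_zero (m : ℕ) {k : ℕ} (hk : 1 ≤ k) : halfWeight m k 0 = 0 := by
  rw [halfWeight, if_neg (by rw [Nat.zero_mod]; omega), Nat.cast_zero, zero_div]

lemma halfWeight_add_mul {m k : ℕ} (hkm : k < m) (c : ℕ) : halfWeight m k (k + c * m) = c := by
  have hm : (m : ℝ) ≠ 0 := by norm_cast; omega
  rw [halfWeight, if_pos (by rw [Nat.add_mul_mod_self_right, Nat.mod_eq_of_lt hkm]), Nat.cast_add,
    add_sub_cancel_left, Nat.cast_mul, mul_div_cancel_right₀ _ hm]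

lemma halfWeight_sub (k : ℕ) {m a c : ℕ} (h : (m : ℤ) ∣ c - a) :
    halfWeight m k c - halfWeight m k a = (c - a) / m := by
  have hmod : c % m = a % m := ((Nat.modEq_iff_dvd (n := m)).2 h).symm
  rw [halfWeight, halfWeight, hmod]
  split_ifs <;> ring

lemma halfWeight_add {m k a c : ℕ} (ha : a % m ≠ k) (hc : c % m ≠ k) :
    halfWeight m k c + halfWeight m k a = (c + a) / m := by
  rw [halfWeight, halfWeight, if_neg ha, if_neg hc, add_div]

lemma prod_range_succ_div (c j : ℕ) :
    ∏ d ∈ Finset.range j, (((c + 1 + d + 1 : ℕ) : ℝ) / (c + 1 + d : ℕ)) =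
      (c + 1 + j : ℕ) / (c + 1 : ℕ) := by
  induction j with
  | zero => rw [Finset.prod_range_zero, add_zero, div_self (Nat.cast_ne_zero.2 c.succ_ne_zero)]
  | succ j ih =>
    rw [Finset.prod_range_succ, ih, mul_comm, ← add_assoc,
      div_mul_div_cancel₀ (Nat.cast_ne_zero.2 (by omega))]

lemma prod_range_prod_range_div (p : ℕ) :
    ∏ c ∈ Finset.range (p + 1), ∏ d ∈ Finset.range c, (((c + d + 1 : ℕ) : ℝ) / (c + d : ℕ)) =
      2 ^ p := by
  have htwo (c : ℕ) : ((c + 1 + (c + 1) : ℕ) : ℝ) / (c + 1 : ℕ) = 2 := by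
    rw [← two_mul, Nat.cast_mul, Nat.cast_two,
      mul_div_cancel_right₀ _ (Nat.cast_ne_zero.2 c.succ_ne_zero)]
  rw [Finset.prod_range_succ', Finset.prod_range_zero, mul_one]
  simp only [prod_range_succ_div, htwo, Finset.prod_const, Finset.card_range]

lemma functional_halfVec_add {V : Type*} [AddCommGroup V] [Module ℝ V] {ε : ℕ → V}
    {n m k p : ℕ} (h : HalfClass n m k p) {φ : V →ₗ[ℝ] ℝ}
    (hφ : ∀ a ≤ n, φ (ε a) = halfWeight m k a) {c d : ℕ} (hc : c ≤ p) (hd : d ≤ p) :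
    φ (halfVec ε m k c + halfVec ε m k d) = (c + d : ℕ) := by
  have hkm : k < m := by
    have := h.eq_two_mul
    have := h.pos
    omega
  rw [map_add, hφ _ (h.add_mul_le hc), hφ _ (h.add_mul_le hd), halfWeight_add_mul hkm,
    halfWeight_add_mul hkm, Nat.cast_add]

section DimConst

variable {ι V N : Type*} [AddCommGroup V] [Module ℝ V] [AddCommGroup N] [Module ℝ N]
  {P : RootPairing ι ℝ V N} {b : P.Base}

section Coroots

variable [Fintype ι] [P.IsCrystallographic] [P.IsReduced]

lemma root'_halfSumCoroots_posRootsMult {m : ℕ} {φ : V →ₗ[ℝ] ℝ}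
    (hφ : ∀ i ∈ simpleRootsMult b m, φ (P.root i) = 1) {i : ι} (hi : i ∈ posRootsMult b m) :
    P.root' i (halfSumCoroots (P := P) (posRootsMult b m)) = φ (P.root i) := by
  change P.toLinearMap (P.root i) _ = _
  have hmem := root_mem_closure_simpleRootsMult b m hi
  generalize P.root i = v at hmem
  induction hmem using AddSubmonoid.closure_induction with
  | mem v hv =>
    obtain ⟨j, hj, rfl⟩ := hv
    rw [hφ j hj]
    exact root'_halfSumCoroots_eq_one hj.1 (fun h => not_isPos_reflectionPerm_self hj.1.2 h.2)
      fun l hl hlj => reflectionPerm_mem_posRootsMult b m hj hl hlj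
  | zero => simp
  | add v w _ _ hv hw => rw [map_add, map_add, LinearMap.add_apply, hv, hw]

variable [P.IsRootSystem]

lemma root'_halfSumCoroots_isPos (i : ι) :
    P.root' i (halfSumCoroots (P := P) {i | b.IsPos i}) = b.height i := by
  have hρ : P.toLinearMap.flip (halfSumCoroots (P := P) {i | b.IsPos i}) = heightFun b := by
    refine b.toWeightBasis.ext fun j => ?_
    have hpos := Base.isPos_of_mem_support j.2
    rw [b.toWeightBasis_apply, heightFun_root_of_mem_support b j.2]
    exact root'_halfSumCoroots_eq_one hpos (not_isPos_reflectionPerm_self hpos)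
      fun l hl hlj => hl.reflectionPerm j.2 hlj
  rw [← heightFun_root, ← hρ]
  rfl

open Classical in
lemma dimConst_eq_prod {m : ℕ} {φ : V →ₗ[ℝ] ℝ} (hφ : ∀ i ∈ simpleRootsMult b m, φ (P.root i) = 1) :
    dimConst b m = ∏ i with i ∈ posRootsMult b m, b.height i / m / φ (P.root i) :=
  Finset.prod_congr rfl fun i hi => by
    rw [root'_halfSumCoroots_posRootsMult hφ (Finset.mem_filter.1 hi).2, map_smul,
      root'_halfSumCoroots_isPos, smul_eq_mul, one_div_mul_eq_div]

end Coroots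

variable [P.IsRootSystem] {X : Family} {n : ℕ} {e : Fin (X.rank n) ≃ b.support}
  {ε : ℕ → V} {g : V →ₗ[ℝ] V →ₗ[ℝ] ℝ} {m k p : ℕ}

namespace Realization

variable (hR : Realization X n e ε g)

include hR

lemma height_of_root_eq_halfVec_add (h : HalfClass n m k p) {c d : ℕ} (hc : c ≤ p) (hd : d ≤ p)
    {i : ι} (hi : P.root i = halfVec ε m k c + halfVec ε m k d) :
    b.height i = ((c + d + 1) * m : ℕ) := by
  rw [hR.height_of_root_eq_add (h.add_mul_le hc) (h.add_mul_le hd) hi, ← Nat.cast_add]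
  congr 1
  rw [h.eq_two_mul]
  ring

lemma exists_root_halfVec_add (h : HalfClass n m k p) {c d : ℕ} (hdc : d < c) (hc : c ≤ p) :
    ∃ i ∈ posRootsMult b m, P.root i = halfVec ε m k c + halfVec ε m k d := by
  have hm := h.one_le_m
  obtain ⟨i, hi⟩ := hR.exists_root_add (a := k + d * m) (c := k + c * m) (by gcongr)
    (h.add_mul_le hc)
  have hheight := hR.height_of_root_eq_halfVec_add h hc (hdc.le.trans hc) hi
  exact ⟨i, mem_posRootsMult_of_height_eq hheight (by exact_mod_cast dvd_mul_left _ _)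
    (by exact_mod_cast Nat.mul_pos (Nat.succ_pos _) hm), hi⟩

lemma functional_eq_or (h : HalfClass n m k p) {φ : V →ₗ[ℝ] ℝ}
    (hφ : ∀ a ≤ n, φ (ε a) = halfWeight m k a) [Finite ι] [P.IsCrystallographic] [P.IsReduced]
    {i : ι} (hi : i ∈ posRootsMult b m) : φ (P.root i) = b.height i / m ∨
      ∃ c d, d < c ∧ c ≤ p ∧ P.root i = halfVec ε m k c + halfVec ε m k d := by
  have hdvd : (m : ℤ) ∣ b.height i := hi.1
  obtain ⟨a, c, hac, hc, hroot | hroot⟩ := hR.root_of_isPos hi.2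
  · have hheight := hR.height_of_root_eq_sub (a := c) (c := a) (by omega) (by omega)
      (by rwa [signed_natCast, signed_natCast])
    left
    rw [hheight] at hdvd ⊢
    rw [hroot, map_sub, hφ c hc, hφ a (by omega), halfWeight_sub k hdvd]
    push_cast
    rfl
  · have hheight := hR.height_of_root_eq_add hc (by omega) hroot
    rw [hheight] at hdvd ⊢
    have hdvd' : m ∣ c + a := by exact_mod_cast hdvd
    by_cases ha : a % m = k
    · have hc' := mod_eq_of_dvd_add h.eq_two_mul h.pos hdvd' ha
      have ha_eq : k + a / m * m = a := ha ▸ Nat.mod_add_div' a m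
      have hc_eq : k + c / m * m = c := hc' ▸ Nat.mod_add_div' c m
      refine .inr ⟨c / m, a / m, ?_, h.le_of_add_mul_le (hc_eq.trans_le hc), ?_⟩
      · exact lt_of_mul_lt_mul_right (a := m) (by omega) m.zero_le
      · rw [halfVec, halfVec, ha_eq, hc_eq, hroot]
    · have hc' : c % m ≠ k := fun hc' =>
        ha (mod_eq_of_dvd_add h.eq_two_mul h.pos (add_comm c a ▸ hdvd') hc')
      left
      rw [hroot, map_add, hφ c hc, hφ a (by omega), halfWeight_add ha hc']
      push_cast
      rfl

lemma halfVec_add_injective (h : HalfClass n m k p) {c d c' d' : ℕ} (hdc : d < c) (hc : c ≤ p)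
    (hdc' : d' < c') (hc' : c' ≤ p)
    (heq : halfVec ε m k c + halfVec ε m k d = halfVec ε m k c' + halfVec ε m k d') :
    c = c' ∧ d = d' := by
  have hmem_iff : ∀ x ≤ p, ((x = c ∨ x = d) ↔ (x = c' ∨ x = d')) := by
    intro x hx
    have hu := hR.orthogonalUpTo_halfVec h
    have hform := congrArg (g (halfVec ε m k x)) heq
    rw [map_add, map_add, hu _ _ hx hc, hu _ _ hx (by omega), hu _ _ hx hc',
      hu _ _ hx (by omega)] at hform
    simp only [Pi.one_apply] at hform
    split_ifs at hform <;> first | omega | norm_num at hform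
  have := hmem_iff c hc
  have := hmem_iff d (by omega)
  have := hmem_iff c' hc'
  omega

lemma functional_eq_one_of_mem_simpleRootsMult [Finite ι] [P.IsCrystallographic] [P.IsReduced]
    (h : HalfClass n m k p) {φ : V →ₗ[ℝ] ℝ} (hφ : ∀ a ≤ n, φ (ε a) = halfWeight m k a) {i : ι}
    (hi : i ∈ simpleRootsMult b m) : φ (P.root i) = 1 := by
  have hm := h.one_le_m
  obtain ⟨δ, -, hδ, -, hΓ⟩ := hR.exists_delta h
  rcases hΓ ▸ hi with hheight | rfl
  · have hheight : b.height i = m := hheight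
    rcases hR.functional_eq_or h hφ hi.1 with hval | ⟨c, d, hdc, hc, hroot⟩
    · rw [hval, hheight, Int.cast_natCast, div_self (Nat.cast_ne_zero.2 (by omega))]
    · have hheight' := hR.height_of_root_eq_halfVec_add h hc (hdc.le.trans hc) hroot
      rw [hheight, Nat.cast_inj] at hheight'
      nlinarith
  · rw [hδ, functional_halfVec_add h hφ h.one_le p.zero_le, add_zero, Nat.cast_one]

/-- Outside the residue class of `k` the functionals `ρ / m` and `ρ_m` agree on `R⁺(m)`. -/
lemma dimConst_eq [Fintype ι] [P.IsCrystallographic] [P.IsReduced] (h : HalfClass n m k p) :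
    dimConst b m = 2 ^ p := by
  classical
  have hm : (m : ℝ) ≠ 0 := Nat.cast_ne_zero.2 (by have := h.one_le_m; omega)
  obtain ⟨φ, hφ⟩ := hR.exists_functional (halfWeight m k) (halfWeight_zero m h.pos)
  have : Nonempty ι := ⟨(hR.exists_delta h).choose⟩
  choose! r hr_mem hr using fun c d hdc hc => hR.exists_root_halfVec_add h (c := c) (d := d) hdc hc
  have hlt : ∀ z ∈ (Finset.range (p + 1)).sigma Finset.range, z.2 < z.1 ∧ z.1 ≤ p := fun z hz => by
    simp only [Finset.mem_sigma, Finset.mem_range] at hz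
    omega
  rw [← prod_range_prod_range_div, Finset.prod_sigma',
    dimConst_eq_prod fun i hi => hR.functional_eq_one_of_mem_simpleRootsMult h hφ hi]
  refine (Finset.prod_of_injOn (fun z => r z.1 z.2) ?_ ?_ ?_ ?_).symm
  · intro z hz z' hz' (heq : r z.1 z.2 = r z'.1 z'.2)
    obtain ⟨hdc, hc⟩ := hlt z hz
    obtain ⟨hdc', hc'⟩ := hlt z' hz'
    obtain ⟨h1, h2⟩ := hR.halfVec_add_injective h hdc hc hdc' hc'
      (by rw [← hr _ _ hdc hc, ← hr _ _ hdc' hc', heq])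
    exact Sigma.ext h1 (heq_of_eq h2)
  · intro z hz
    simpa using hr_mem _ _ (hlt z hz).1 (hlt z hz).2
  · intro i hi hi'
    have hi := (Finset.mem_filter.1 hi).2
    rcases hR.functional_eq_or h hφ hi with hval | ⟨c, d, hdc, hc, hroot⟩
    · have hheight : (b.height i : ℝ) ≠ 0 := by
        have : 0 < b.height i := hi.2
        exact_mod_cast this.ne'
      rw [hval, div_self (div_ne_zero hheight hm)]
    · refine absurd ⟨⟨c, d⟩, ?_, P.root.injective ((hr c d hdc hc).trans hroot.symm)⟩ hi'
      simpa only [Finset.coe_sigma, Set.mem_sigma_iff, Finset.coe_range, Set.mem_Iio,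
        Nat.lt_succ_iff] using ⟨hc, hdc⟩
  · intro z hz
    obtain ⟨hdc, hc⟩ := hlt z hz
    rw [hr _ _ hdc hc, functional_halfVec_add h hφ hc (hdc.le.trans hc),
      hR.height_of_root_eq_halfVec_add h hc (hdc.le.trans hc) (hr _ _ hdc hc), Int.cast_natCast,
      Nat.cast_mul, mul_div_cancel_right₀ _ hm]

end Realization

end DimConst

section Rows

variable {ι V N : Type*} [AddCommGroup V] [Module ℝ V] [AddCommGroup N] [Module ℝ N]
  {P : RootPairing ι ℝ V N} {b : P.Base} [P.IsRootSystem] [P.IsCrystallographic] [P.IsReduced]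
  {X : Family} {n : ℕ} {e : Fin (X.rank n) ≃ b.support} {ε : ℕ → V} {g : V →ₗ[ℝ] V →ₗ[ℝ] ℝ}
  {m k q t i : ℕ}

namespace Realization

variable (hR : Realization X n e ε g)

include hR

lemma hasType_rootsMult_low [Finite ι] {d : ℕ} (hnq : n = q * m + t) (hq : 1 ≤ q)
    (ht : 2 * t < m) (hd : ∀ r, 2 * r < m ↔ r ≤ d) (h : ∀ k, m = 2 * k → n < 3 * k) :
    HasType P (rootsMult b m)
      (X.BD q ⊕ᴅ copies t (typeA (2 * q)) ⊕ᴅ copies (d - t) (typeA (2 * q - 1))) := by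
  rw [show 2 * q - 1 = q + (q - 1) by omega, two_mul]
  exact hR.hasType_rootsMult (residueCover_low hnq hq ht hd) (by omega) hq hnq (by omega) h

lemma hasType_rootsMult_high [Finite ι] (hnq : n = q * m + t) (hq : 1 ≤ q) (hmk : m = 2 * k + 1)
    (hi : 1 ≤ i) (hik : i ≤ k) (htk : t = k + i) :
    HasType P (rootsMult b m)
      (X.BD q ⊕ᴅ copies i (typeA (2 * q + 1)) ⊕ᴅ copies (k - i) (typeA (2 * q))) := by
  rw [show 2 * q + 1 = q + 1 + q by omega, two_mul, show k - i = m - 1 - t by omega,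
    show i = k + t + 1 - m by omega]
  have hcover := residueCover_high (d := k) hnq (by omega) (by omega) (by omega)
  exact hR.hasType_rootsMult hcover.symm (by omega) hq hnq (by omega) (by omega)

lemma tableRow_low [Fintype ι] (hnq : n = q * m + t) (hq : 2 ≤ q) (hmk : m = 2 * k) (htk : t < k) :
    TableRow X n e m k (q - 1)
      (X.BD q ⊕ᴅ copies t (typeA (2 * q)) ⊕ᴅ copies (k - 1 - t) (typeA (2 * q - 1))) := by
  obtain ⟨p, rfl⟩ := Nat.exists_eq_add_of_le' (Nat.one_le_of_lt hq)
  have hmul := add_one_mul p m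
  have hclass : HalfClass n m k p := ⟨hmk, by omega, by omega, by omega, by omega⟩
  rw [show 2 * (p + 1) - 1 = p + 1 + p by omega, two_mul]
  exact hR.tableRow_of_dimConst hclass (residueCover_low hnq (by omega) (by omega) (by omega))
    (by omega) hnq (by omega) (hR.dimConst_eq hclass)

lemma tableRow_high [Fintype ι] (hnq : n = q * m + t) (hq : 1 ≤ q) (hmk : m = 2 * k) (hik : i < k)
    (htk : t = k + i) :
    TableRow X n e m k q
      (X.BD q ⊕ᴅ copies (k - 1 - i) (typeA (2 * q)) ⊕ᴅ copies i (typeA (2 * q + 1))) := by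
  have hmul := add_one_mul q m
  have hclass : HalfClass n m k q := ⟨hmk, by omega, hq, by omega, by omega⟩
  rw [show 2 * q + 1 = q + 1 + q by omega, two_mul, show k - 1 - i = m - 1 - t by omega,
    show i = k - 1 + t + 1 - m by omega]
  exact hR.tableRow_of_dimConst hclass (residueCover_high hnq (by omega) (by omega) (by omega))
    hq hnq (by omega) (hR.dimConst_eq hclass)

end Realization

end Rows

end HeightSubsystem

theorem mainTheorem4_general {ι V N : Type*} [Fintype ι] [AddCommGroup V] [Module ℝ V]
    [AddCommGroup N] [Module ℝ N]
    (P : RootPairing ι ℝ V N) [P.IsRootSystem] [P.IsCrystallographic] [P.IsReduced]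
    (b : P.Base) (X : Family) (n : ℕ) (e : Fin (X.rank n) ≃ b.support)
    (he : ∀ x y, b.cartanMatrix (e x) (e y) = X.BD n x y)
    (m q t k : ℕ) (hmn : m ≤ n) (hqt : n = q * m + t) (ht : t < m) :
    (m = 2 * k + 1 →
      IsLeviType b (rootsMult b m) ∧
      (∀ i, 1 ≤ i → i ≤ k → t = k + i →
        HasType P (rootsMult b m)
          (X.BD q ⊕ᴅ copies i (typeA (2 * q + 1)) ⊕ᴅ copies (k - i) (typeA (2 * q)))) ∧
      (t ≤ k →
        HasType P (rootsMult b m)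
          (X.BD q ⊕ᴅ copies t (typeA (2 * q)) ⊕ᴅ copies (k - t) (typeA (2 * q - 1))))) ∧
    (m = 2 * k → n = m + t → t < k →
      HasType P (rootsMult b m)
        (X.BD 1 ⊕ᴅ copies t (typeA 2) ⊕ᴅ copies (k - 1 - t) (typeA 1)) ∧
      IsLeviType b (rootsMult b m)) ∧
    (m = 2 * k → 3 * k ≤ n →
      ¬ IsLeviType b (rootsMult b m) ∧
      (∀ i, i < k → t = k + i →
        TableRow X n e m k q
          (X.BD q ⊕ᴅ copies (k - 1 - i) (typeA (2 * q)) ⊕ᴅ copies i (typeA (2 * q + 1)))) ∧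
      (2 ≤ q → t < k →
        TableRow X n e m k (q - 1)
          (X.BD q ⊕ᴅ copies t (typeA (2 * q)) ⊕ᴅ copies (k - 1 - t) (typeA (2 * q - 1))))) := by
  have hR := realization_eps (by omega) he
  have hq : 1 ≤ q := by
    by_contra! hq
    obtain rfl : q = 0 := by omega
    omega
  refine ⟨fun hmk => ⟨hR.isLeviType_rootsMult (by omega), fun i hi hik htk => ?_, fun htk => ?_⟩,
    fun hmk hnt htk => ⟨?_, hR.isLeviType_rootsMult (by omega)⟩,
    fun hmk hkn => ⟨hmk ▸ hR.not_isLeviType_rootsMult (by omega) hkn, fun i hik htk => ?_,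
      fun hq htk => ?_⟩⟩
  · exact hR.hasType_rootsMult_high hqt hq hmk hi hik htk
  · exact hR.hasType_rootsMult_low hqt hq (by omega) (by omega) (by omega)
  · exact hR.hasType_rootsMult_low (q := 1) (by omega) le_rfl (by omega) (by omega) (by omega)
  · exact hR.tableRow_high hqt hq hmk hik htk
  · exact hR.tableRow_low hqt hq hmk htk

theorem mainTheorem4 {ι V N : Type*} [Fintype ι] [AddCommGroup V] [Module ℝ V]
    [AddCommGroup N] [Module ℝ N]
    (P : RootPairing ι ℝ V N) [P.IsRootSystem] [P.IsCrystallographic] [P.IsReduced]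
    (b : P.Base)
    -- `R` is of type `B_n` or `D_{n+1}`, with `n ≥ 3`
    (X : Family) (n : ℕ) (hn : 3 ≤ n)
    (e : Fin (X.rank n) ≃ b.support)
    (he : ∀ x y, b.cartanMatrix (e x) (e y) = X.BD n x y)
    (m q t k : ℕ) (hm : 1 ≤ m) (hmn : m ≤ n) (hqt : n = q * m + t) (ht : t < m) (hk : k = m / 2) :
    -- (a)
    (m = 2 * k + 1 →
      IsLeviType b (rootsMult b m) ∧
      (∀ i, 1 ≤ i → i ≤ k → t = k + i →
        HasType P (rootsMult b m)
          (X.BD q ⊕ᴅ copies i (typeA (2 * q + 1)) ⊕ᴅ copies (k - i) (typeA (2 * q)))) ∧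
      (t ≤ k →
        HasType P (rootsMult b m)
          (X.BD q ⊕ᴅ copies t (typeA (2 * q)) ⊕ᴅ copies (k - t) (typeA (2 * q - 1))))) ∧
    -- (b)
    (m = 2 * k → n = m + t → t < k →
      HasType P (rootsMult b m)
        (X.BD 1 ⊕ᴅ copies t (typeA 2) ⊕ᴅ copies (k - 1 - t) (typeA 1)) ∧
      IsLeviType b (rootsMult b m)) ∧
    -- (c)
    (m = 2 * k → 3 * k ≤ n →
      ¬ IsLeviType b (rootsMult b m) ∧
      (∀ i, i < k → t = k + i →
        TableRow X n e m k q
          (X.BD q ⊕ᴅ copies (k - 1 - i) (typeA (2 * q)) ⊕ᴅ copies i (typeA (2 * q + 1)))) ∧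
      (2 ≤ q → t < k →
        TableRow X n e m k (q - 1)
          (X.BD q ⊕ᴅ copies t (typeA (2 * q)) ⊕ᴅ copies (k - 1 - t) (typeA (2 * q - 1))))) :=
  mainTheorem4_general P b X n e he m q t k hmn hqt ht
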